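/- Let $a,b,c>0$. The dihedral graph with parameters $a,b,c$ is the metric graph with vertices $v_0,v_1,v_2,v_3$ and four edges: one of length $a$ joining $v_0$ to $v_1$, two parallel edges of lengths $2b$ and $2c$ joining $v_1$ to $v_2$, and one of length $a$ joining $v_2$ to $v_3$. Its eigenvalues are the numbers $\lambda$ for which there is a nonzero function $f$ with $-f''=\lambda f$ on every edge, $f=0$ at $v_0$ (Dirichlet condition), and at each of $v_1,v_2,v_3$ the Neumann conditions: $f$ is continuous and the derivatives of $f$, taken from the vertex into the incident edges, sum to zero. The multiplicity of $\lambda$ is the dimension of the space of such $f$. The eigenvalues are real and form an infinite ascending list $\lambda_1\le\lambda_2\le\cdots$ in which each is repeated according to its multiplicity. Let $\tilde\lambda_1\le\tilde\lambda_2\le\cdots$ be the elements of $$\tilde\sigma=\left\{\frac{\pi n_1}{2a}\right\}_{n_1=1,2,\ldots}\cup\left\{\frac{\pi n_2}{2(b+c)}\right\}_{n_2=1,2,\ldots}$$ (a union in the sense of multisets) in ascending order, repeated according to multiplicity. Then $$\sqrt{\lambda_n}\le\tilde\lambda_n\le\sqrt{\lambda_{n+1}}\qquad\text{for all } n=1,2,\ldots$$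 -/

import Mathlib

open Set

noncomputable section

/-- A compact quantum graph with vertex set `V` and edge set `E`, zero potential, and a Neumann or
Dirichlet condition at every vertex. The edge `e` is a copy of the interval `[0, length e]`; its
end `0` is attached to the vertex `vert (e, false)` and its end `length e` to `vert (e, true)`.
Loops and multiple edges are allowed. -/
structure QuantumGraph (V E : Type) where
  length : E → ℝ
  length_pos : ∀ e, 0 < length e
  vert : E × Bool → V
  /-- The vertices with the Dirichlet condition; all other vertices are Neumann. -/
  dirichlet : Set V

namespace QuantumGraph

variable {V E : Type} (Γ : QuantumGraph V E)

/-- The closed interval underlying the edge `e`. -/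
abbrev interval (e : E) : Set ℝ := Icc 0 (Γ.length e)

/-- A function on the graph: a collection of functions defined on the individual edges. -/
abbrev EdgeFun : Type := (e : E) → Γ.interval e → ℂ

variable {Γ}

/-- The component of `f` on the edge `e` as a function of a real variable. Only its restriction to
`Γ.interval e`, where it agrees with `f e`, is ever used. -/
def onEdge (f : Γ.EdgeFun) (e : E) : ℝ → ℂ :=
  IccExtend (Γ.length_pos e).le (f e)

/-- The value of `f` at an end of an edge. -/
def endValue (f : Γ.EdgeFun) : E × Bool → ℂ
  | (e, false) => onEdge f e 0
  | (e, true) => onEdge f e (Γ.length e)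

/-- The one-sided derivative of `f` at an end of an edge, directed from the vertex into the
edge. -/
def endDeriv (f : Γ.EdgeFun) : E × Bool → ℂ
  | (e, false) => derivWithin (onEdge f e) (Γ.interval e) 0
  | (e, true) => -derivWithin (onEdge f e) (Γ.interval e) (Γ.length e)

variable (Γ) [Fintype E] [DecidableEq V]

/-- `f` solves the eigenvalue problem on `Γ` with spectral parameter `μ`: `-f'' = μ f` on every
edge, `f` is continuous at every vertex, vanishes at the Dirichlet vertices, and satisfies the
current conservation condition at the Neumann vertices. The zero function is included. -/
structure SolvesEigenproblem (μ : ℂ) (f : Γ.EdgeFun) : Prop where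
  contDiffOn : ∀ e, ContDiffOn ℝ 2 (onEdge f e) (Γ.interval e)
  equation : ∀ e, ∀ x ∈ Γ.interval e,
    -derivWithin (derivWithin (onEdge f e) (Γ.interval e)) (Γ.interval e) x = μ * onEdge f e x
  continuous : ∀ p q, Γ.vert p = Γ.vert q → endValue f p = endValue f q
  vanish : ∀ p, Γ.vert p ∈ Γ.dirichlet → endValue f p = 0
  current : ∀ v, v ∉ Γ.dirichlet →
    ∑ p ∈ Finset.univ.filter (fun p => Γ.vert p = v), endDeriv f p = 0

variable {Γ} in
theorem SolvesEigenproblem.hasDeriv {μ : ℂ} {f : Γ.EdgeFun} (h : Γ.SolvesEigenproblem μ f) (e : E)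
    {x : ℝ} (hx : x ∈ Γ.interval e) :
    DifferentiableWithinAt ℝ (onEdge f e) (Γ.interval e) x ∧
    DifferentiableWithinAt ℝ (derivWithin (onEdge f e) (Γ.interval e)) (Γ.interval e) x :=
  ⟨(h.contDiffOn e).differentiableOn (by norm_num) x hx,
    ((h.contDiffOn e).derivWithin (m := 1) (uniqueDiffOn_Icc (Γ.length_pos e))
      (by norm_num)).differentiableOn (by norm_num) x hx⟩

/-- The space of solutions of the eigenvalue problem with spectral parameter `μ`. -/
def eigenspace (μ : ℂ) : Submodule ℂ Γ.EdgeFun where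
  carrier := {f | Γ.SolvesEigenproblem μ f}
  zero_mem' := by
    have h0 : ∀ e, onEdge (0 : Γ.EdgeFun) e = fun _ => 0 := fun e => rfl
    have hv : ∀ p, endValue (0 : Γ.EdgeFun) p = 0 := by rintro ⟨e, _ | _⟩ <;> rfl
    refine ⟨fun e => ?_, fun e x _ => ?_, fun p q _ => ?_, fun p _ => hv p, fun v _ => ?_⟩
    · rw [h0]; exact contDiffOn_const
    · simp [h0]
    · rw [hv, hv]
    · refine Finset.sum_eq_zero ?_
      rintro ⟨e, _ | _⟩ _ <;> simp [endDeriv, h0]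
  add_mem' := by
    intro f g hf hg
    have h0 : ∀ e, onEdge (f + g) e = onEdge f e + onEdge g e := fun e => rfl
    have h1 : ∀ e, ∀ x ∈ Γ.interval e, derivWithin (onEdge (f + g) e) (Γ.interval e) x =
        (derivWithin (onEdge f e) (Γ.interval e) + derivWithin (onEdge g e) (Γ.interval e)) x :=
      fun e x hx => by
        rw [h0]; exact derivWithin_add (hf.hasDeriv e hx).1 (hg.hasDeriv e hx).1
    have hv : ∀ p, endValue (f + g) p = endValue f p + endValue g p := by
      rintro ⟨e, _ | _⟩ <;> rfl
    have hd : ∀ p, endDeriv (f + g) p = endDeriv f p + endDeriv g p := by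
      rintro ⟨e, _ | _⟩
      · exact h1 e 0 ⟨le_rfl, (Γ.length_pos e).le⟩
      · simp only [endDeriv, h1 e _ (right_mem_Icc.2 (Γ.length_pos e).le), Pi.add_apply]; ring
    refine ⟨fun e => ?_, fun e x hx => ?_, fun p q hpq => ?_, fun p hp => ?_, fun v hvd => ?_⟩
    · rw [h0]; exact (hf.contDiffOn e).add (hg.contDiffOn e)
    · rw [derivWithin_congr (h1 e) (h1 e x hx),
        derivWithin_add (hf.hasDeriv e hx).2 (hg.hasDeriv e hx).2, h0, Pi.add_apply, mul_add,
        ← hf.equation e x hx, ← hg.equation e x hx]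
      ring
    · rw [hv, hv, hf.continuous p q hpq, hg.continuous p q hpq]
    · rw [hv, hf.vanish p hp, hg.vanish p hp, add_zero]
    · simp only [hd, Finset.sum_add_distrib, hf.current v hvd, hg.current v hvd, add_zero]
  smul_mem' := by
    intro c f hf
    have h0 : ∀ e, onEdge (c • f) e = c • onEdge f e := fun e => rfl
    have h1 : ∀ e, ∀ x ∈ Γ.interval e, derivWithin (onEdge (c • f) e) (Γ.interval e) x =
        (c • derivWithin (onEdge f e) (Γ.interval e)) x :=
      fun e x hx => by
        rw [h0]; exact derivWithin_const_smul c (hf.hasDeriv e hx).1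
    have hv : ∀ p, endValue (c • f) p = c * endValue f p := by
      rintro ⟨e, _ | _⟩ <;> rfl
    have hd : ∀ p, endDeriv (c • f) p = c * endDeriv f p := by
      rintro ⟨e, _ | _⟩
      · exact h1 e 0 ⟨le_rfl, (Γ.length_pos e).le⟩
      · simp only [endDeriv, h1 e _ (right_mem_Icc.2 (Γ.length_pos e).le), Pi.smul_apply,
          smul_eq_mul]
        ring
    refine ⟨fun e => ?_, fun e x hx => ?_, fun p q hpq => ?_, fun p hp => ?_, fun v hvd => ?_⟩
    · rw [h0]; exact (hf.contDiffOn e).const_smul c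
    · rw [derivWithin_congr (h1 e) (h1 e x hx),
        derivWithin_const_smul c (hf.hasDeriv e hx).2, h0, Pi.smul_apply, smul_eq_mul, smul_eq_mul,
        mul_left_comm, ← hf.equation e x hx]
      ring
    · rw [hv, hv, hf.continuous p q hpq]
    · rw [hv, hf.vanish p hp, mul_zero]
    · simp only [hd, ← Finset.mul_sum, hf.current v hvd, mul_zero]

/-- The multiplicity of `μ` as an eigenvalue of `Γ` (zero if `μ` is not an eigenvalue). -/
def multiplicity (μ : ℂ) : ℕ∞ := Cardinal.toENat (Module.rank ℂ (Γ.eigenspace μ))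

/-- `lam 0 ≤ lam 1 ≤ ...` is the list of all eigenvalues of `Γ` in ascending order, repeated
according to multiplicity. -/
def IsOrderedSpectrum (lam : ℕ → ℝ) : Prop :=
  Monotone lam ∧ ∀ μ : ℂ, {n : ℕ | (lam n : ℂ) = μ}.encard = Γ.multiplicity μ

end QuantumGraph

/-- The dihedral graph. Vertices: `0` is the Dirichlet leaf, `1` and `2` are the left and the right
attachment points of the cycle, `3` is the Neumann leaf. Edges: edge `0` of length `a` joins `0` to
`1`, edges `1` and `2` of lengths `2b` and `2c` both join `1` to `2`, edge `3` of length `a` joins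
`2` to `3`. -/
def dihedralGraph (a b c : ℝ) (ha : 0 < a) (hb : 0 < b) (hc : 0 < c) :
    QuantumGraph (Fin 4) (Fin 4) where
  length := ![a, 2 * b, 2 * c, a]
  length_pos := by
    intro e
    fin_cases e <;> simp [ha, hb, hc]
  vert p := if p.2 then ![1, 2, 2, 3] p.1 else ![0, 1, 1, 2] p.1
  dirichlet := {0}

/-- `s 0 ≤ s 1 ≤ ...` is the list, in ascending order and repeated according to multiplicity, of
the elements of the union, in the sense of multisets, of `{π n₁ / (2a)}` and `{π n₂ / (2(b+c))}`,
where `n₁` and `n₂` run over the positive integers. -/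
def IsOrderedSigmaTilde (a b c : ℝ) (s : ℕ → ℝ) : Prop :=
  Monotone s ∧ ∀ x : ℝ, {n : ℕ | s n = x}.encard =
    {n₁ : ℕ | 1 ≤ n₁ ∧ Real.pi / (2 * a) * n₁ = x}.encard +
    {n₂ : ℕ | 1 ≤ n₂ ∧ Real.pi / (2 * (b + c)) * n₂ = x}.encard

end

open Filter Topology in
/-- `g` has the qualitative behaviour of the cotangent with set of poles `Q`: it is continuous and
strictly decreasing off `Q`, and at every pole it jumps from `-∞` to `+∞`. -/
structure IsCotangentLike (g : ℝ → ℝ) (Q : Set ℝ) : Prop where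
  continuousAt : ∀ p ∉ Q, ContinuousAt g p
  tendsto_right : ∀ p ∈ Q, Tendsto g (𝓝[>] p) atTop
  tendsto_left : ∀ p ∈ Q, Tendsto g (𝓝[<] p) atBot
  lt_of_lt : ∀ x y, x < y → (∀ z ∈ Icc x y, z ∉ Q) → g y < g x

namespace IsCotangentLike

open Filter Topology

variable {g h : ℝ → ℝ} {P Q : Set ℝ}

theorem add (hg : IsCotangentLike g P) (hh : IsCotangentLike h Q) :
    IsCotangentLike (fun x => g x + h x) (P ∪ Q) where
  continuousAt p hp := by
    simp only [mem_union, not_or] at hp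
    exact (hg.continuousAt p hp.1).add (hh.continuousAt p hp.2)
  tendsto_right p hp := by
    by_cases h1 : p ∈ P <;> by_cases h2 : p ∈ Q
    · exact (hg.tendsto_right p h1).atTop_add_atTop (hh.tendsto_right p h2)
    · exact (hg.tendsto_right p h1).atTop_add
        ((hh.continuousAt p h2).tendsto.mono_left nhdsWithin_le_nhds)
    · exact ((hg.continuousAt p h1).tendsto.mono_left nhdsWithin_le_nhds).add_atTop
        (hh.tendsto_right p h2)
    · exact absurd hp (by simp [h1, h2])
  tendsto_left p hp := by
    by_cases h1 : p ∈ P <;> by_cases h2 : p ∈ Q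
    · exact (hg.tendsto_left p h1).atBot_add_atBot (hh.tendsto_left p h2)
    · exact (hg.tendsto_left p h1).atBot_add
        ((hh.continuousAt p h2).tendsto.mono_left nhdsWithin_le_nhds)
    · exact ((hg.continuousAt p h1).tendsto.mono_left nhdsWithin_le_nhds).add_atBot
        (hh.tendsto_left p h2)
    · exact absurd hp (by simp [h1, h2])
  lt_of_lt x y hxy hz :=
    add_lt_add (hg.lt_of_lt x y hxy fun z hzI hzP => hz z hzI (Or.inl hzP))
      (hh.lt_of_lt x y hxy fun z hzI hzQ => hz z hzI (Or.inr hzQ))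

/-- Between two zeros there is a pole. -/
theorem exists_pole_between (hg : IsCotangentLike g Q) {x y : ℝ} (hxy : x < y) (hx : x ∉ Q)
    (hy : y ∉ Q) (hgx : g x = 0) (hgy : g y = 0) : ∃ q ∈ Q, x < q ∧ q < y := by
  by_contra! hcon
  have := hg.lt_of_lt x y hxy fun z hz hzQ => by
    rcases hz.1.eq_or_lt with rfl | h1
    · exact hx hzQ
    rcases hz.2.eq_or_lt with rfl | h2
    · exact hy hzQ
    exact (hcon z hzQ h1).not_gt h2
  linarith

/-- Between two consecutive poles there is a zero. -/
theorem exists_zero_between (hg : IsCotangentLike g Q) {p q : ℝ} (hp : p ∈ Q) (hq : q ∈ Q)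
    (hpq : p < q) (hQ : ∀ x ∈ Ioo p q, x ∉ Q) : ∃ z ∈ Ioo p q, g z = 0 := by
  obtain ⟨x, hx, hx'⟩ := (((hg.tendsto_right p hp).eventually_gt_atTop 0).and
    (Ioo_mem_nhdsGT hpq)).exists
  obtain ⟨y, hy, hy'⟩ := (((hg.tendsto_left q hq).eventually_lt_atBot 0).and
    (Ioo_mem_nhdsLT hx'.2)).exists
  have hcont : ContinuousOn g (Icc x y) := fun z hz =>
    (hg.continuousAt z (hQ z ⟨hx'.1.trans_le hz.1, hz.2.trans_lt hy'.2⟩)).continuousWithinAt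
  obtain ⟨z, hz, hz0⟩ := intermediate_value_Icc' hy'.1.le hcont ⟨hy.le, hx.le⟩
  exact ⟨z, ⟨hx'.1.trans_le hz.1, hz.2.trans_lt hy'.2⟩, hz0⟩

/-- The positive zeros and the positive poles alternate, a zero coming first. -/
theorem finite_and_ncard_le (hg : IsCotangentLike g Q) (h0 : 0 ∈ Q)
    (hfin : ∀ K, (Q ∩ Icc 0 K).Finite) (K : ℝ) :
    ({k | 0 < k ∧ k ∉ Q ∧ g k = 0} ∩ Iic K).Finite ∧
    (Q ∩ Ioi 0 ∩ Iic K).ncard ≤ ({k | 0 < k ∧ k ∉ Q ∧ g k = 0} ∩ Iic K).ncard ∧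
    ({k | 0 < k ∧ k ∉ Q ∧ g k = 0} ∩ Iic K).ncard ≤ (Q ∩ Ioi 0 ∩ Iic K).ncard + 1 := by
  set Z : Set ℝ := {k | 0 < k ∧ k ∉ Q ∧ g k = 0}
  have hpred : ∀ x, 0 < x → ∃ q ∈ Q, 0 ≤ q ∧ q < x ∧ ∀ q' ∈ Q, q' < x → q' ≤ q := by
    intro x hx
    have hf : (Q ∩ Ico 0 x).Finite :=
      (hfin x).subset (inter_subset_inter_right _ Ico_subset_Icc_self)
    obtain ⟨q, hq, hmax⟩ := hf.exists_maximalFor id _ ⟨0, h0, le_rfl, hx⟩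
    refine ⟨q, hq.1, hq.2.1, hq.2.2, fun q' hq' hlt => ?_⟩
    by_contra! hcon
    exact hcon.not_ge (hmax ⟨hq', hq.2.1.trans hcon.le, hlt⟩ hcon.le)
  have hZQ : ∀ z ∈ Z, ∃ q ∈ Q, 0 ≤ q ∧ q < z ∧ ∀ z' ∈ Z, z' < z → z' < q := by
    intro z hz
    obtain ⟨q, hq, hq0, hqz, hmax⟩ := hpred z hz.1
    refine ⟨q, hq, hq0, hqz, fun z' hz' hlt => ?_⟩
    obtain ⟨p, hp, h1, h2⟩ := hg.exists_pole_between hlt hz'.2.1 hz.2.1 hz'.2.2 hz.2.2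
    exact h1.trans_le (hmax p hp h2)
  have hQZ : ∀ q ∈ Q ∩ Ioi 0, ∃ z ∈ Z, z < q ∧ ∀ q' ∈ Q, q' < q → q' < z := by
    intro q hq
    obtain ⟨p, hp, hp0, hpq, hmax⟩ := hpred q hq.2
    have hno : ∀ x ∈ Ioo p q, x ∉ Q := fun x hx hxQ => (hmax x hxQ hx.2).not_gt hx.1
    obtain ⟨z, hz, hz0⟩ := hg.exists_zero_between hp hq.1 hpq hno
    exact ⟨z, ⟨hp0.trans_lt hz.1, hno z hz, hz0⟩, hz.2,
      fun q' hq' hlt => (hmax q' hq' hlt).trans_lt hz.1⟩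
  choose! u hu huz hu0 hu' using hZQ
  choose! v hv hv' hvq using hQZ
  have huinj : InjOn u (Z ∩ Iic K) := by
    intro z hz z' hz' heq
    rcases lt_trichotomy z z' with h | h | h
    · have := hu' z' hz'.1 z hz.1 h
      have := hu0 z hz.1
      linarith
    · exact h
    · have := hu' z hz.1 z' hz'.1 h
      have := hu0 z' hz'.1
      linarith
  have hvinj : InjOn v (Q ∩ Ioi 0 ∩ Iic K) := by
    intro z hz z' hz' heq
    rcases lt_trichotomy z z' with h | h | h
    · have := hvq z' hz'.1 z hz.1.1 h
      have := hv' z hz.1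
      linarith
    · exact h
    · have := hvq z hz.1 z' hz'.1.1 h
      have := hv' z' hz'.1
      linarith
  have humaps : MapsTo u (Z ∩ Iic K) (Q ∩ Icc 0 K) := fun z hz =>
    ⟨hu z hz.1, huz z hz.1, (hu0 z hz.1).le.trans hz.2⟩
  have hvmaps : MapsTo v (Q ∩ Ioi 0 ∩ Iic K) (Z ∩ Iic K) := fun q hq =>
    ⟨hv q hq.1, (hv' q hq.1).le.trans hq.2⟩
  have hZfin : (Z ∩ Iic K).Finite := Finite.of_injOn humaps huinj (hfin K)
  refine ⟨hZfin, ncard_le_ncard_of_injOn v hvmaps hvinj hZfin, ?_⟩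
  have hQfin : (Q ∩ Ioi 0 ∩ Iic K).Finite :=
    (hfin K).subset fun x hx => ⟨hx.1.1, (show (0:ℝ) < x from hx.1.2).le, hx.2⟩
  calc (Z ∩ Iic K).ncard ≤ (Q ∩ Icc 0 K).ncard := ncard_le_ncard_of_injOn u humaps huinj (hfin K)
    _ ≤ (insert 0 (Q ∩ Ioi 0 ∩ Iic K)).ncard := by
        refine ncard_le_ncard (fun x hx => ?_) (hQfin.insert 0)
        rcases hx.2.1.eq_or_lt with h | h
        · exact Or.inl h.symm
        · exact Or.inr ⟨⟨hx.1, h⟩, hx.2.2⟩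
    _ ≤ _ := ncard_insert_le _ _

end IsCotangentLike

section

open Filter Topology Real

theorem tendsto_div_of_simple_zero {N D : ℝ → ℝ} {p D' : ℝ} (hN : ContinuousAt N p)
    (hD : HasDerivAt D D' p) (hDp : D p = 0) (hD' : D' ≠ 0) (hpos : 0 < N p / D') :
    Tendsto (fun x => N x / D x) (𝓝[>] p) atTop ∧
      Tendsto (fun x => N x / D x) (𝓝[<] p) atBot := by
  have hslope : Tendsto (fun x => D x / (x - p)) (𝓝[≠] p) (𝓝 D') := by
    refine (hasDerivAt_iff_tendsto_slope.1 hD).congr fun x => ?_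
    rw [slope_def_field, hDp, sub_zero]
  have hquot : Tendsto (fun x => N x / (D x / (x - p))) (𝓝[≠] p) (𝓝 (N p / D')) :=
    (hN.tendsto.mono_left nhdsWithin_le_nhds).div hslope hD'
  have heq : ∀ x, x ≠ p → N x / (D x / (x - p)) * (x - p)⁻¹ = N x / D x := by
    intro x hx
    have : x - p ≠ 0 := sub_ne_zero.2 hx
    rw [div_div_eq_mul_div, mul_div_right_comm, mul_assoc, mul_inv_cancel₀ this, mul_one]
  have hsub : Tendsto (fun x : ℝ => x - p) (𝓝 p) (𝓝 0) := by
    have : ContinuousAt (fun x : ℝ => x - p) p := by fun_prop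
    simpa [ContinuousAt] using this
  constructor
  · have h1 : Tendsto (fun x : ℝ => (x - p)⁻¹) (𝓝[>] p) atTop := by
      refine tendsto_inv_nhdsGT_zero.comp (tendsto_nhdsWithin_iff.2
        ⟨hsub.mono_left nhdsWithin_le_nhds, ?_⟩)
      filter_upwards [self_mem_nhdsWithin] with x hx using mem_Ioi.2 (sub_pos.2 (mem_Ioi.1 hx))
    refine ((hquot.mono_left (nhdsWithin_mono p fun x hx => ne_of_gt hx)).pos_mul_atTop hpos
      h1).congr' ?_
    filter_upwards [self_mem_nhdsWithin] with x hx using heq x (ne_of_gt hx)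
  · have h1 : Tendsto (fun x : ℝ => (x - p)⁻¹) (𝓝[<] p) atBot := by
      refine tendsto_inv_nhdsLT_zero.comp (tendsto_nhdsWithin_iff.2
        ⟨hsub.mono_left nhdsWithin_le_nhds, ?_⟩)
      filter_upwards [self_mem_nhdsWithin] with x hx using mem_Iio.2 (sub_neg.2 (mem_Iio.1 hx))
    refine ((hquot.mono_left (nhdsWithin_mono p fun x hx => ne_of_lt hx)).pos_mul_atBot hpos
      h1).congr' ?_
    filter_upwards [self_mem_nhdsWithin] with x hx using heq x (ne_of_lt hx)

theorem div_lt_div_of_deriv_neg {N D N' D' : ℝ → ℝ} {x y : ℝ} (hxy : x < y)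
    (hN : ∀ z, HasDerivAt N (N' z) z) (hD : ∀ z, HasDerivAt D (D' z) z)
    (hD0 : ∀ z ∈ Icc x y, D z ≠ 0)
    (hneg : ∀ z ∈ Icc x y, N' z * D z - N z * D' z < 0) : N y / D y < N x / D x := by
  have hd : ∀ z ∈ Icc x y, HasDerivAt (fun z => N z / D z)
      ((N' z * D z - N z * D' z) / D z ^ 2) z := fun z hz => (hN z).div (hD z) (hD0 z hz)
  refine strictAntiOn_of_deriv_neg (convex_Icc x y)
    (fun z hz => (hd z hz).continuousAt.continuousWithinAt) (fun z hz => ?_)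
    (left_mem_Icc.2 hxy.le) (right_mem_Icc.2 hxy.le) hxy
  have hz' := interior_subset hz
  rw [(hd z hz').deriv]
  exact div_neg_of_neg_of_pos (hneg z hz') (by have := hD0 z hz'; positivity)

end

section

open Filter Topology Real

theorem isCotangentLike_cos_div_sin {ω : ℝ} (hω : 0 < ω) :
    IsCotangentLike (fun k => 2 * cos (ω * k) / sin (ω * k)) {k | sin (ω * k) = 0} := by
  have hN : ∀ z, HasDerivAt (fun k => 2 * cos (ω * k)) (2 * (-sin (ω * z) * ω)) z := fun z => by
    simpa using (((hasDerivAt_id z).const_mul ω).cos).const_mul 2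
  have hD : ∀ z, HasDerivAt (fun k => sin (ω * k)) (cos (ω * z) * ω) z := fun z => by
    simpa using ((hasDerivAt_id z).const_mul ω).sin
  have hpole : ∀ p ∈ {k | sin (ω * k) = 0}, cos (ω * p) * ω ≠ 0 ∧
      0 < 2 * cos (ω * p) / (cos (ω * p) * ω) := by
    intro p hp
    have hc : cos (ω * p) ≠ 0 := fun hc => by
      have := sin_sq_add_cos_sq (ω * p)
      rw [show sin (ω * p) = 0 from hp, hc] at this
      norm_num at this
    refine ⟨mul_ne_zero hc hω.ne', ?_⟩
    rw [mul_comm 2, mul_div_mul_left _ _ hc]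
    positivity
  refine ⟨fun p hp => ((hN p).continuousAt).div (hD p).continuousAt hp,
    fun p hp => (tendsto_div_of_simple_zero (hN p).continuousAt (hD p) hp
      (hpole p hp).1 (hpole p hp).2).1,
    fun p hp => (tendsto_div_of_simple_zero (hN p).continuousAt (hD p) hp
      (hpole p hp).1 (hpole p hp).2).2,
    fun x y hxy hz => div_lt_div_of_deriv_neg hxy hN hD hz fun z _ => ?_⟩
  have := sin_sq_add_cos_sq (ω * z)
  have h2 : 2 * (-sin (ω * z) * ω) * sin (ω * z) - 2 * cos (ω * z) * (cos (ω * z) * ω) =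
    -(2 * ω) * (sin (ω * z) ^ 2 + cos (ω * z) ^ 2) := by ring
  rw [h2, this]
  linarith

theorem sin_sq_le_sin_sq_of_abs_le {u v : ℝ} (huv : |u| ≤ |v|) (hv : |v| ≤ π / 2) :
    sin u ^ 2 ≤ sin v ^ 2 := by
  have habs : ∀ w : ℝ, sin w ^ 2 = sin |w| ^ 2 := fun w => by
    rcases abs_cases w with h | h <;> simp [h.1]
  rw [habs u, habs v]
  have h1 : 0 ≤ sin |u| := sin_nonneg_of_nonneg_of_le_pi (abs_nonneg u)
    (by linarith [pi_pos])
  have h2 : sin |u| ≤ sin |v| := sin_le_sin_of_le_of_le_pi_div_two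
    (by linarith [abs_nonneg u, pi_pos]) hv huv
  gcongr

/-- The contribution of the cycle to the secular function. -/
noncomputable def cycleSecular (l d k : ℝ) : ℝ :=
  (sin (d * k) ^ 2 - 5 * sin (l * k) ^ 2) / sin (2 * (l * k))

def cyclePoles (l d : ℝ) : Set ℝ :=
  {k | cos (l * k) = 0 ∨ (sin (l * k) = 0 ∧ sin (d * k) ≠ 0)}

theorem sin_sq_eq_of_sin_eq_zero {u r : ℝ} (hr : sin r = 0) : sin u ^ 2 = sin (u - r) ^ 2 := by
  have := sin_sq_add_cos_sq r
  rw [sin_sub, hr]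
  rw [hr] at this
  have h2 : cos r ^ 2 = 1 := by linarith
  linear_combination (-sin u ^ 2) * h2

variable {l d : ℝ}

theorem sin_mul_sq_le_near (hd : |d| < l) {r k : ℝ} (h1 : sin (l * r) = 0) (h2 : sin (d * r) = 0)
    (hk : |l * (k - r)| ≤ π / 2) : sin (d * k) ^ 2 ≤ sin (l * k) ^ 2 := by
  rw [sin_sq_eq_of_sin_eq_zero (u := l * k) h1, sin_sq_eq_of_sin_eq_zero (u := d * k) h2,
    ← mul_sub, ← mul_sub]
  refine sin_sq_le_sin_sq_of_abs_le ?_ hk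
  rw [abs_mul, abs_mul]
  exact mul_le_mul_of_nonneg_right (hd.le.trans (le_abs_self l)) (abs_nonneg _)

theorem continuousAt_cycleSecular_of_removable (hd : |d| < l) {r : ℝ} (h1 : sin (l * r) = 0)
    (h2 : sin (d * r) = 0) : ContinuousAt (cycleSecular l d) r := by
  have hr0 : cycleSecular l d r = 0 := by simp [cycleSecular, h1, h2]
  have hc : cos (l * r) ≠ 0 := fun hc => by
    have := sin_sq_add_cos_sq (l * r)
    rw [h1, hc] at this
    norm_num at this
  have hlim : Tendsto (fun k => 5 / 2 * |sin (l * k) / cos (l * k)|) (𝓝 r) (𝓝 0) := by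
    have : ContinuousAt (fun k => 5 / 2 * |sin (l * k) / cos (l * k)|) r := by
      have h3 : ContinuousAt (fun k => sin (l * k) / cos (l * k)) r :=
        ContinuousAt.div (by fun_prop) (by fun_prop) hc
      exact h3.abs.const_mul _
    simpa [ContinuousAt, h1] using this
  rw [ContinuousAt, hr0]
  refine squeeze_zero_norm' ?_ hlim
  have hnear : ∀ᶠ k in 𝓝 r, |l * (k - r)| < π / 2 := by
    have : ContinuousAt (fun k => |l * (k - r)|) r := by fun_prop
    refine this.eventually_lt continuousAt_const ?_
    simp [pi_pos]
  filter_upwards [hnear] with k hk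
  have hle := sin_mul_sq_le_near hd h1 h2 hk.le
  rw [cycleSecular, sin_two_mul, norm_eq_abs, abs_div, abs_div]
  by_cases hs : sin (l * k) = 0
  · simp [hs]
  by_cases hck : cos (l * k) = 0
  · simp [hck]
  have hnum : |sin (d * k) ^ 2 - 5 * sin (l * k) ^ 2| ≤ 5 * |sin (l * k)| ^ 2 := by
    rw [sq_abs, abs_le]
    constructor <;> nlinarith [sq_nonneg (sin (d * k)), sq_nonneg (sin (l * k))]
  have hs' := abs_pos.2 hs
  have hc' := abs_pos.2 hck
  rw [abs_mul, abs_mul, abs_two, div_le_iff₀ (by positivity)]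
  refine hnum.trans (le_of_eq ?_)
  field_simp

theorem cycleSecular_derivative_numerator_neg (hd : |d| < l) {k : ℝ} (hs : sin (l * k) ≠ 0) :
    (2 * sin (d * k) * (cos (d * k) * d) - 5 * (2 * sin (l * k) * (cos (l * k) * l))) *
      sin (2 * (l * k)) -
    (sin (d * k) ^ 2 - 5 * sin (l * k) ^ 2) * (cos (2 * (l * k)) * (2 * l)) < 0 := by
  rw [sin_two_mul, cos_two_mul']
  have e1 := sin_sq_add_cos_sq (l * k)
  have e2 := sin_sq_add_cos_sq (d * k)
  have hl : 0 < l := (abs_nonneg d).trans_lt hd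
  set S := sin (l * k)
  set C := cos (l * k)
  set s := sin (d * k)
  set c := cos (d * k)
  have hS : 0 < S ^ 2 := by positivity
  have hkey : d * (2 * (s * C) * (c * S)) ≤ l * ((s * C) ^ 2 + (c * S) ^ 2) := by
    have h1 := (abs_lt.1 hd)
    nlinarith [sq_nonneg (s * C - c * S), sq_nonneg (s * C + c * S)]
  have hid : (2 * s * (c * d) - 5 * (2 * S * (C * l))) * (2 * S * C) -
      (s ^ 2 - 5 * S ^ 2) * ((C ^ 2 - S ^ 2) * (2 * l)) =
      2 * (d * (2 * (s * C) * (c * S)) - l * ((s * C) ^ 2 + (c * S) ^ 2)) -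
        2 * l * S ^ 2 * (5 * (S ^ 2 + C ^ 2) - (s ^ 2 + c ^ 2)) + 0 := by ring
  rw [hid, e1, e2]
  have : 0 < l * S ^ 2 := by positivity
  nlinarith

theorem isCotangentLike_cycleSecular (hd : |d| < l) :
    IsCotangentLike (cycleSecular l d) (cyclePoles l d) := by
  have hl : 0 < l := (abs_nonneg d).trans_lt hd
  have hN : ∀ z, HasDerivAt (fun k => sin (d * k) ^ 2 - 5 * sin (l * k) ^ 2)
      (2 * sin (d * z) * (cos (d * z) * d) - 5 * (2 * sin (l * z) * (cos (l * z) * l))) z := by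
    intro z
    have h1 := (((hasDerivAt_id z).const_mul d).sin).pow 2
    have h2 := ((((hasDerivAt_id z).const_mul l).sin).pow 2).const_mul 5
    simp only [id, mul_one, Nat.cast_ofNat, Nat.add_one_sub_one, pow_one] at h1 h2
    exact h1.sub h2
  have hD : ∀ z, HasDerivAt (fun k => sin (2 * (l * k))) (cos (2 * (l * z)) * (2 * l)) z := by
    intro z
    simpa using (((hasDerivAt_id z).const_mul l).const_mul 2).sin
  have hpole : ∀ p ∈ cyclePoles l d, Tendsto (cycleSecular l d) (𝓝[>] p) atTop ∧
      Tendsto (cycleSecular l d) (𝓝[<] p) atBot := by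
    intro p hp
    have e1 := sin_sq_add_cos_sq (l * p)
    have hsd := sin_sq_le_one (d * p)
    refine tendsto_div_of_simple_zero (hN p).continuousAt (hD p) ?_ ?_ ?_
    · rw [sin_two_mul]
      rcases hp with h | h
      · simp [h]
      · simp [h.1]
    · rw [cos_two_mul']
      rcases hp with h | h
      · rw [h] at e1 ⊢
        have : sin (l * p) ^ 2 = 1 := by linarith
        rw [this]
        have := hl.ne'
        simpa
      · rw [h.1] at e1 ⊢
        have : cos (l * p) ^ 2 = 1 := by linarith
        rw [this]
        have := hl.ne'
        simpa
    · rw [cos_two_mul']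
      rcases hp with h | h
      · rw [h] at e1 ⊢
        have : sin (l * p) ^ 2 = 1 := by linarith
        rw [this]
        refine div_pos_of_neg_of_neg ?_ ?_ <;> nlinarith
      · rw [h.1] at e1 ⊢
        have : cos (l * p) ^ 2 = 1 := by linarith
        rw [this]
        have := h.2
        refine div_pos ?_ ?_
        · have : 0 < sin (d * p) ^ 2 := by positivity
          linarith
        · linarith
  refine ⟨fun p hp => ?_, fun p hp => (hpole p hp).1, fun p hp => (hpole p hp).2,
    fun x y hxy hz => ?_⟩
  · simp only [cyclePoles, mem_ofPred_eq, not_or, not_and, not_not] at hp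
    by_cases hs : sin (l * p) = 0
    · exact continuousAt_cycleSecular_of_removable hd hs (hp.2 hs)
    · refine (hN p).continuousAt.div (hD p).continuousAt ?_
      rw [sin_two_mul]
      simp [hs, hp.1]
  · have hz' : ∀ z ∈ Icc x y, cos (l * z) ≠ 0 := fun z hzm hc => hz z hzm (Or.inl hc)
    by_cases hs : ∀ z ∈ Icc x y, sin (l * z) ≠ 0
    · refine div_lt_div_of_deriv_neg hxy hN hD (fun z hzm => ?_)
        fun z hzm => cycleSecular_derivative_numerator_neg hd (hs z hzm)
      rw [sin_two_mul]
      simp [hs z hzm, hz' z hzm]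
    push Not at hs
    obtain ⟨r, hr, hsr⟩ := hs
    have hdr : sin (d * r) = 0 := by
      by_contra hcon
      exact hz r hr (Or.inr ⟨hsr, hcon⟩)
    have hcr : ∀ z ∈ Icc x y, |l * (z - r)| < π / 2 := by
      intro z hzm
      by_contra! hcon
      have hcos : ∀ w, cos (l * (r + w)) = 0 ↔ cos (l * w) = 0 := fun w => by
        rw [mul_add, cos_add, hsr]
        simp [hz' r hr]
      have hpl : l * (π / 2 / l) = π / 2 := by field_simp
      have hpl0 : 0 < π / 2 / l := by positivity
      rw [abs_mul, abs_of_pos hl, mul_comm, ← div_le_iff₀ hl] at hcon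
      rcases le_abs.1 hcon with h | h
      · refine hz' (r + π / 2 / l) ⟨by linarith [hr.1], by linarith [hzm.2]⟩ ?_
        rw [hcos, hpl, cos_pi_div_two]
      · refine hz' (r + -(π / 2 / l)) ⟨by linarith [hzm.1], by linarith [hr.2]⟩ ?_
        rw [hcos, mul_neg, hpl, cos_neg, cos_pi_div_two]
    have hsin2 : ∀ z, sin (2 * (l * z)) = sin (2 * (l * (z - r))) := fun z => by
      have : 2 * (l * z) = 2 * (l * (z - r)) + 2 * (l * r) := by ring
      have h1 : sin (2 * (l * r)) = 0 := by rw [sin_two_mul, hsr]; simp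
      have h2 : cos (2 * (l * r)) = 1 := by rw [cos_two_mul', cos_sq', hsr]; simp
      rw [this, sin_add, h1, h2]
      ring
    have hnum : ∀ z ∈ Icc x y, z ≠ r → sin (d * z) ^ 2 - 5 * sin (l * z) ^ 2 < 0 := by
      intro z hzm hzr
      have h1 := sin_mul_sq_le_near hd hsr hdr (hcr z hzm).le
      have h2 : 0 < sin (l * z) ^ 2 := by
        rw [sin_sq_eq_of_sin_eq_zero hsr, ← mul_sub]
        have h3 := abs_lt.1 (hcr z hzm)
        have : sin (l * (z - r)) ≠ 0 := by
          rw [Ne, sin_eq_zero_iff_of_lt_of_lt (by linarith) (by linarith)]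
          exact mul_ne_zero hl.ne' (sub_ne_zero.2 hzr)
        positivity
      linarith
    have hr0 : cycleSecular l d r = 0 := by simp [cycleSecular, hsr, hdr]
    have hleft : x < r → 0 < cycleSecular l d x := fun hxr => by
      have hxm : x ∈ Icc x y := left_mem_Icc.2 hxy.le
      have h3 := abs_lt.1 (hcr x hxm)
      refine div_pos_of_neg_of_neg (hnum x hxm hxr.ne) ?_
      rw [hsin2]
      exact sin_neg_of_neg_of_neg_pi_lt (by nlinarith) (by linarith)
    have hright : r < y → cycleSecular l d y < 0 := fun hry => by
      have hym : y ∈ Icc x y := right_mem_Icc.2 hxy.le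
      have h3 := abs_lt.1 (hcr y hym)
      refine div_neg_of_neg_of_pos (hnum y hym hry.ne') ?_
      rw [hsin2]
      exact sin_pos_of_pos_of_lt_pi (by nlinarith) (by linarith)
    rcases hr.1.eq_or_lt with h | h
    · rw [h, hr0]
      exact hright (h ▸ hxy)
    rcases hr.2.eq_or_lt with h' | h'
    · rw [← h', hr0]
      exact hleft h
    · exact (hright h').trans (hleft h)

end

section

/-- The multiplicity function of the union, in the sense of multisets, of two sets of reals. -/
noncomputable def pairMultiplicity (A B : Set ℝ) (x : ℝ) : ℕ∞ := A.indicator 1 x + B.indicator 1 x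

/-- `s 0 ≤ s 1 ≤ ...` lists the reals, each `x` being repeated `m x` times. -/
def IsEnumeration (m : ℝ → ℕ∞) (s : ℕ → ℝ) : Prop :=
  Monotone s ∧ ∀ x, {n : ℕ | s n = x}.encard = m x

theorem encard_inter_singleton {α : Type*} (A : Set α) (x : α) :
    (A ∩ {x}).encard = A.indicator 1 x := by
  by_cases h : x ∈ A
  · simp [h, inter_eq_right.2 (singleton_subset_iff.2 h)]
  · simp [h, inter_singleton_eq_empty.2 h]

theorem encard_biUnion_eq_sum {ι α : Type*} {U : Finset ι} {S : ι → Set α}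
    (hS : (U : Set ι).PairwiseDisjoint S) : (⋃ x ∈ U, S x).encard = ∑ x ∈ U, (S x).encard := by
  classical
  induction U using Finset.induction_on with
  | empty => simp
  | insert x U hx ih =>
    rw [Finset.set_biUnion_insert, Finset.sum_insert hx, encard_union_eq, ih]
    · exact hS.subset (by simp)
    · refine disjoint_iUnion₂_right.2 fun y hy => hS (by simp) (by simp [hy]) ?_
      rintro rfl
      exact hx hy

theorem isLowerSet_eq_Iio_of_encard {S : Set ℕ} (hS : IsLowerSet S) {N : ℕ} (hN : S.encard = N) :
    S = Iio N := by
  have hfin : S.Finite := finite_of_encard_eq_coe hN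
  rcases hS.eq_univ_or_Iio with h | ⟨M, h⟩
  · rw [h] at hfin
    exact absurd hfin infinite_univ
  · rw [h] at hN ⊢
    have h2 : (Iio M).encard = M := by
      rw [← Finset.coe_Iio, encard_coe_eq_coe_finsetCard, Nat.card_Iio]
    rw [h2] at hN
    rw [Nat.cast_inj.1 hN]

variable {A B : Set ℝ}

theorem IsEnumeration.le_iff {s : ℕ → ℝ} (hs : IsEnumeration (pairMultiplicity A B) s)
    (hA : ∀ K, (A ∩ Iic K).Finite) (hB : ∀ K, (B ∩ Iic K).Finite) (n : ℕ) (K : ℝ) :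
    s n ≤ K ↔ n < (A ∩ Iic K).ncard + (B ∩ Iic K).ncard := by
  classical
  set U : Finset ℝ := (hA K).toFinset ∪ (hB K).toFinset with hU
  have hmemU : ∀ x, x ∈ U ↔ (x ∈ A ∨ x ∈ B) ∧ x ≤ K := fun x => by
    simp [hU, or_and_right]
  have hmem : ∀ n, s n ∈ A ∨ s n ∈ B := by
    intro n
    by_contra! hcon
    have h := hs.2 (s n)
    rw [pairMultiplicity, indicator_of_notMem hcon.1, indicator_of_notMem hcon.2, add_zero,
      encard_eq_zero] at h
    exact (h ▸ (rfl : n ∈ {m | s m = s n}) : n ∈ (∅ : Set ℕ))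
  have hcount : ∀ C : Set ℝ, (hC : (C ∩ Iic K).Finite) → (C ⊆ A ∪ B) →
      ∑ x ∈ U, C.indicator (1 : ℝ → ℕ∞) x = (C ∩ Iic K).ncard := by
    intro C hC hsub
    rw [Set.ncard_eq_toFinset_card _ hC, Finset.card_eq_sum_ones, Nat.cast_sum]
    have : hC.toFinset = U.filter (· ∈ C) := by
      ext x
      simp only [Finite.mem_toFinset, mem_inter_iff, mem_Iic, Finset.mem_filter, hmemU]
      constructor
      · exact fun h => ⟨⟨hsub h.1, h.2⟩, h.1⟩
      · exact fun h => ⟨h.2, h.1.2⟩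
    rw [this, Finset.sum_filter]
    refine Finset.sum_congr rfl fun x _ => ?_
    simp [indicator_apply]
  have hset : {n | s n ≤ K} = ⋃ x ∈ U, {n | s n = x} := by
    ext n
    simp only [mem_ofPred_eq, mem_iUnion, hmemU, exists_prop]
    exact ⟨fun h => ⟨s n, ⟨hmem n, h⟩, rfl⟩, fun ⟨x, hx, h⟩ => h ▸ hx.2⟩
  have hcard : {n | s n ≤ K}.encard = ((A ∩ Iic K).ncard + (B ∩ Iic K).ncard : ℕ) := by
    have hdisj : (U : Set ℝ).PairwiseDisjoint fun x => {n : ℕ | s n = x} := by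
      intro x _ y _ hxy
      refine disjoint_left.2 fun n hn hn' => hxy ?_
      exact (show s n = x from hn).symm.trans hn'
    rw [hset, encard_biUnion_eq_sum hdisj]
    simp only [hs.2, pairMultiplicity, Finset.sum_add_distrib]
    rw [hcount A (hA K) subset_union_left, hcount B (hB K) subset_union_right, Nat.cast_add]
  have := isLowerSet_eq_Iio_of_encard (fun m n hmn hm => (hs.1 hmn).trans hm) hcard
  exact Set.ext_iff.1 this n

theorem exists_isEnumeration (hA : ∀ K, (A ∩ Iic K).Finite) (hB : ∀ K, (B ∩ Iic K).Finite)
    (hinf : A.Infinite) : ∃ s, IsEnumeration (pairMultiplicity A B) s := by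
  set N : ℝ → ℕ := fun K => (A ∩ Iic K).ncard + (B ∩ Iic K).ncard with hNdef
  have hNmono : Monotone N := fun x y hxy => add_le_add
    (ncard_le_ncard (inter_subset_inter_right _ (Iic_subset_Iic.2 hxy)) (hA y))
    (ncard_le_ncard (inter_subset_inter_right _ (Iic_subset_Iic.2 hxy)) (hB y))
  have hfinU : ∀ K, ((A ∪ B) ∩ Iic K).Finite := fun K => by
    rw [union_inter_distrib_right]
    exact (hA K).union (hB K)
  -- `N` is constant from the last point of `A ∪ B` on
  have hconst : ∀ x y, x ≤ y → (∀ z ∈ A ∪ B, z ≤ y → z ≤ x) → N y = N x := by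
    intro x y hxy h
    have : ∀ C ⊆ A ∪ B, C ∩ Iic y = C ∩ Iic x := fun C hC =>
      Subset.antisymm (fun z hz => ⟨hz.1, h z (hC hz.1) hz.2⟩)
        (inter_subset_inter_right _ (Iic_subset_Iic.2 hxy))
    simp only [hNdef, this A subset_union_left, this B subset_union_right]
  have hunb : ∀ n, ∃ K, n < N K := by
    intro n
    obtain ⟨t, htA, htn⟩ := hinf.exists_subset_card_eq (n + 1)
    obtain ⟨K, hK⟩ := t.bddAbove
    refine ⟨K, ?_⟩
    have : (t : Set ℝ).ncard ≤ (A ∩ Iic K).ncard :=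
      ncard_le_ncard (fun x hx => ⟨htA hx, hK hx⟩) (hA K)
    rw [ncard_coe_finset, htn] at this
    simp only [hNdef]
    omega
  have hleast : ∀ n, ∃ k, n < N k ∧ ∀ x, n < N x → k ≤ x := by
    intro n
    obtain ⟨K, hK⟩ := hunb n
    have hpt : ∀ x, n < N x → ∃ k ∈ A ∪ B, k ≤ x ∧ n < N k := by
      intro x hx
      have hne : ((A ∪ B) ∩ Iic x).Nonempty := by
        by_contra hcon
        rw [not_nonempty_iff_eq_empty, union_inter_distrib_right, union_empty_iff] at hcon
        simp [hNdef, hcon.1, hcon.2] at hx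
      obtain ⟨k, hk, hmax⟩ := (hfinU x).exists_maximalFor id _ hne
      refine ⟨k, hk.1, hk.2, ?_⟩
      rwa [← hconst k x hk.2]
      intro z hz hzx
      by_contra! hcon
      exact hcon.not_ge (hmax ⟨hz, hzx⟩ hcon.le)
    obtain ⟨k₀, hk₀, hk₀K, hNk₀⟩ := hpt K hK
    have hf : {k | k ∈ A ∪ B ∧ k ≤ K ∧ n < N k}.Finite :=
      (hfinU K).subset fun k hk => ⟨hk.1, hk.2.1⟩
    obtain ⟨k, hk, hmin⟩ := hf.exists_minimalFor id _ ⟨k₀, hk₀, hk₀K, hNk₀⟩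
    refine ⟨k, hk.2.2, fun x hx => ?_⟩
    by_contra! hcon
    obtain ⟨k', hk', hk'x, hNk'⟩ := hpt x hx
    have := hmin ⟨hk', (hk'x.trans hcon.le).trans hk.2.1, hNk'⟩ (hk'x.trans hcon.le)
    simp only [id] at this
    linarith
  choose s hs hmin using hleast
  have hgc : ∀ n x, s n ≤ x ↔ n < N x := fun n x =>
    ⟨fun h => (hs n).trans_le (hNmono h), hmin n x⟩
  refine ⟨s, fun m n hmn => (hgc m _).2 (hmn.trans_lt (hs n)), fun x => ?_⟩
  obtain ⟨y, hyx, hy⟩ : ∃ y < x, ∀ z ∈ A ∪ B, z < x → z ≤ y := by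
    have hf : ((A ∪ B) ∩ Iio x).Finite :=
      (hfinU x).subset (inter_subset_inter_right _ Iio_subset_Iic_self)
    rcases ((A ∪ B) ∩ Iio x).eq_empty_or_nonempty with h | h
    · exact ⟨x - 1, by linarith, fun z hz hzx => absurd (h ▸ ⟨hz, hzx⟩ : z ∈ (∅ : Set ℝ)) (by simp)⟩
    · obtain ⟨y, hy, hmax⟩ := hf.exists_maximalFor id _ h
      refine ⟨y, hy.2, fun z hz hzx => ?_⟩
      by_contra! hcon
      exact hcon.not_ge (hmax ⟨hz, hzx⟩ hcon.le)
  have hlt : ∀ n, s n < x ↔ n < N y := by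
    intro n
    refine ⟨fun h => ?_, fun h => ((hgc n y).2 h).trans_lt hyx⟩
    have := hs n
    rcases le_total (s n) y with h' | h'
    · exact (hgc n y).1 h'
    · rwa [hconst y (s n) h' fun z hz hzs => hy z hz (hzs.trans_lt h)] at this
  have hset : {n | s n = x} = Ico (N y) (N x) := by
    ext n
    rw [mem_ofPred_eq, mem_Ico, le_antisymm_iff, hgc, ← not_lt (a := s n), hlt, not_lt, and_comm]
  have hsplit : ∀ C ⊆ A ∪ B, (C ∩ Iic x).encard = (C ∩ Iic y).encard + (C ∩ {x}).encard := by
    intro C hC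
    rw [← encard_union_eq]
    · congr 1
      ext z
      simp only [mem_inter_iff, mem_Iic, mem_union, mem_singleton_iff, ← and_or_left]
      refine and_congr_right fun hz => ⟨fun h => ?_, ?_⟩
      · rcases h.eq_or_lt with h | h
        · exact Or.inr h
        · exact Or.inl (hy z (hC hz) h)
      · rintro (h | h)
        · exact h.trans hyx.le
        · exact h.le
    · refine disjoint_left.2 fun z hz hz' => ?_
      have h1 : z ≤ y := hz.2
      have h2 : z = x := hz'.2
      linarith
  have hN : ∀ K, (N K : ℕ∞) = (A ∩ Iic K).encard + (B ∩ Iic K).encard := fun K => by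
    simp only [hNdef, Nat.cast_add, (hA K).cast_ncard_eq, (hB K).cast_ncard_eq]
  have hNx : (N x : ℕ∞) = N y + pairMultiplicity A B x := by
    rw [hN, hN, hsplit A subset_union_left, hsplit B subset_union_right, pairMultiplicity,
      encard_inter_singleton, encard_inter_singleton]
    ring
  rw [hset, ← Finset.coe_Ico, encard_coe_eq_coe_finsetCard, Nat.card_Ico]
  have hadd : (N x : ℕ∞) = N y + (N x - N y : ℕ) := by
    rw [← Nat.cast_add, Nat.add_sub_cancel' (hNmono hyx.le)]
  exact ENat.add_right_injective_of_ne_top (ENat.natCast_ne_top _) (hadd.symm.trans hNx)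

/-- Two lists interlace if their counting functions do. -/
theorem IsEnumeration.interlace {A' : Set ℝ} {s t : ℕ → ℝ}
    (hs : IsEnumeration (pairMultiplicity A B) s) (ht : IsEnumeration (pairMultiplicity A' B) t)
    (hA : ∀ K, (A ∩ Iic K).Finite) (hA' : ∀ K, (A' ∩ Iic K).Finite)
    (hB : ∀ K, (B ∩ Iic K).Finite)
    (h1 : ∀ K, (A' ∩ Iic K).ncard ≤ (A ∩ Iic K).ncard)
    (h2 : ∀ K, (A ∩ Iic K).ncard ≤ (A' ∩ Iic K).ncard + 1) (n : ℕ) :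
    s n ≤ t n ∧ t n ≤ s (n + 1) := by
  constructor
  · rw [hs.le_iff hA hB]
    have := (ht.le_iff hA' hB n (t n)).1 le_rfl
    have := h1 (t n)
    omega
  · rw [ht.le_iff hA' hB]
    have := (hs.le_iff hA hB (n + 1) (s (n + 1))).1 le_rfl
    have := h2 (s (n + 1))
    omega

end

namespace QuantumGraph

open ComplexConjugate

variable {V E : Type} {Γ : QuantumGraph V E}

theorem onEdge_of_mem (f : Γ.EdgeFun) (e : E) {x : ℝ} (hx : x ∈ Γ.interval e) :
    onEdge f e x = f e ⟨x, hx⟩ :=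
  IccExtend_of_mem _ _ hx

theorem zero_mem_interval (e : E) : (0 : ℝ) ∈ Γ.interval e := left_mem_Icc.2 (Γ.length_pos e).le

theorem length_mem_interval (e : E) : Γ.length e ∈ Γ.interval e :=
  right_mem_Icc.2 (Γ.length_pos e).le

theorem uniqueDiffWithinAt_interval {e : E} {x : ℝ} (hx : x ∈ Γ.interval e) :
    UniqueDiffWithinAt ℝ (Γ.interval e) x :=
  uniqueDiffOn_Icc (Γ.length_pos e) x hx

theorem derivWithin_onEdge_of_eqOn {f : Γ.EdgeFun} {e : E} {g : ℝ → ℂ} {g' : ℂ} {x : ℝ}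
    (hg : EqOn (onEdge f e) g (Γ.interval e)) (hx : x ∈ Γ.interval e) (h : HasDerivAt g g' x) :
    derivWithin (onEdge f e) (Γ.interval e) x = g' :=
  (h.hasDerivWithinAt.congr hg (hg hx)).derivWithin (uniqueDiffWithinAt_interval hx)

section

variable [Fintype E] [DecidableEq V] {μ : ℂ} {f : Γ.EdgeFun}

theorem SolvesEigenproblem.hasDerivWithinAt (h : Γ.SolvesEigenproblem μ f) {e : E} {x : ℝ}
    (hx : x ∈ Γ.interval e) :
    HasDerivWithinAt (onEdge f e) (derivWithin (onEdge f e) (Γ.interval e) x) (Γ.interval e) x :=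
  (h.hasDeriv e hx).1.hasDerivWithinAt

theorem SolvesEigenproblem.hasDerivWithinAt_derivWithin (h : Γ.SolvesEigenproblem μ f) {e : E}
    {x : ℝ} (hx : x ∈ Γ.interval e) :
    HasDerivWithinAt (derivWithin (onEdge f e) (Γ.interval e)) (-(μ * onEdge f e x))
      (Γ.interval e) x := by
  rw [← h.equation e x hx, neg_neg]
  exact (h.hasDeriv e hx).2.hasDerivWithinAt

/-- The boundary terms of the integration by parts cancel. -/
theorem SolvesEigenproblem.sum_endDeriv_mul_conj (h : Γ.SolvesEigenproblem μ f) :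
    ∑ p, endDeriv f p * conj (endValue f p) = 0 := by
  rw [← Finset.sum_fiberwise_of_maps_to (g := Γ.vert) (t := Finset.univ.image Γ.vert)
    (fun p _ => Finset.mem_image_of_mem _ (Finset.mem_univ p))]
  refine Finset.sum_eq_zero fun v hv => ?_
  obtain ⟨q, -, rfl⟩ := Finset.mem_image.1 hv
  have : ∀ p ∈ Finset.univ.filter (fun p => Γ.vert p = Γ.vert q),
      endDeriv f p * conj (endValue f p) = endDeriv f p * conj (endValue f q) := fun p hp => by
    rw [h.continuous p q (Finset.mem_filter.1 hp).2]
  rw [Finset.sum_congr rfl this, ← Finset.sum_mul]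
  by_cases hq : Γ.vert q ∈ Γ.dirichlet
  · rw [h.vanish q hq, map_zero, mul_zero]
  · rw [h.current _ hq, zero_mul]

/-- If `μ` is not a positive real, the solutions are constant on the edges. -/
theorem SolvesEigenproblem.derivWithin_eq_zero (h : Γ.SolvesEigenproblem μ f)
    (hμ : ∀ r : ℝ, 0 < r → μ ≠ r) {e : E} {x : ℝ} (hx : x ∈ Γ.interval e) :
    derivWithin (onEdge f e) (Γ.interval e) x = 0 := by
  obtain ⟨ω, hω, hωμ⟩ : ∃ ω : ℂ, ω.re = 1 ∧ (ω * μ).re ≤ 0 := by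
    by_cases hi : μ.im = 0
    · refine ⟨1, rfl, ?_⟩
      by_contra! hcon
      rw [one_mul] at hcon
      exact hμ _ hcon (Complex.ext rfl (by simp [hi]))
    · refine ⟨⟨1, μ.re / μ.im⟩, rfl, ?_⟩
      rw [Complex.mul_re, div_mul_cancel₀ _ hi]
      simp
  set W : E → ℝ → ℝ := fun e x =>
    (ω * (derivWithin (onEdge f e) (Γ.interval e) x * conj (onEdge f e x))).re with hW
  have hWd : ∀ e, ∀ x ∈ Γ.interval e, HasDerivWithinAt (W e)
      (‖derivWithin (onEdge f e) (Γ.interval e) x‖ ^ 2 + -(ω * μ).re * ‖onEdge f e x‖ ^ 2)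
      (Γ.interval e) x := by
    intro e x hx
    have h1 := h.hasDerivWithinAt hx
    have h2 := h.hasDerivWithinAt_derivWithin hx
    have h3 := (h2.mul h1.star).const_mul ω
    have h4 := Complex.reCLM.hasFDerivAt.comp_hasDerivWithinAt x h3
    refine h4.congr_deriv ?_
    have e1 := Complex.mul_conj (derivWithin (onEdge f e) (Γ.interval e) x)
    have e2 := Complex.mul_conj (onEdge f e x)
    rw [Complex.normSq_eq_norm_sq] at e1 e2
    have e3 : ω * (-(μ * onEdge f e x) * conj (onEdge f e x) +
        derivWithin (onEdge f e) (Γ.interval e) x *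
          conj (derivWithin (onEdge f e) (Γ.interval e) x)) =
        ω * (‖derivWithin (onEdge f e) (Γ.interval e) x‖ ^ 2 : ℝ) -
          ω * μ * (‖onEdge f e x‖ ^ 2 : ℝ) := by
      rw [← e1, ← e2]; ring
    refine (congrArg Complex.re e3).trans ?_
    rw [Complex.sub_re, Complex.re_mul_ofReal, Complex.re_mul_ofReal, hω]
    ring
  have hmono : ∀ e, MonotoneOn (W e) (Γ.interval e) := fun e => by
    refine monotoneOn_of_hasDerivWithinAt_nonneg (convex_Icc _ _)
      (fun x hx => (hWd e x hx).continuousWithinAt)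
      (fun x hx => (hWd e x (interior_subset hx)).mono interior_subset) fun x _ => ?_
    have := mul_nonneg (neg_nonneg.2 hωμ) (sq_nonneg ‖onEdge f e x‖)
    positivity
  have hinc : ∀ e, 0 ≤ W e (Γ.length e) - W e 0 := fun e => sub_nonneg.2
    (hmono e (zero_mem_interval e) (length_mem_interval e) (Γ.length_pos e).le)
  have hsum : ∑ e, (W e (Γ.length e) - W e 0) = 0 := by
    have h1 := h.sum_endDeriv_mul_conj
    rw [Fintype.sum_prod_type] at h1
    simp only [Fintype.sum_bool, endDeriv, endValue] at h1
    have h2 := congrArg (fun z => (-ω * z).re) h1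
    simp only [Finset.mul_sum, Complex.re_sum, mul_zero, Complex.zero_re] at h2
    refine (Finset.sum_congr rfl fun e _ => ?_).trans h2
    simp only [hW, ← Complex.sub_re]
    congr 1
    ring
  have hends : W e (Γ.length e) = W e 0 := sub_eq_zero.1
    ((Finset.sum_eq_zero_iff_of_nonneg fun e _ => hinc e).1 hsum e (Finset.mem_univ e))
  have hconst : ∀ y ∈ Γ.interval e, W e y = W e 0 := fun y hy => le_antisymm
    ((hmono e hy (length_mem_interval e) hy.2).trans hends.le)
    (hmono e (zero_mem_interval e) hy hy.1)
  have hzero := (uniqueDiffWithinAt_interval hx).eq_deriv _ (hWd e x hx)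
    ((hasDerivWithinAt_const x _ (W e 0)).congr hconst (hconst x hx))
  have h5 := mul_nonneg (neg_nonneg.2 hωμ) (sq_nonneg ‖onEdge f e x‖)
  have h6 : ‖derivWithin (onEdge f e) (Γ.interval e) x‖ ^ 2 = 0 := by
    have := sq_nonneg ‖derivWithin (onEdge f e) (Γ.interval e) x‖
    linarith
  simpa using h6

theorem SolvesEigenproblem.onEdge_eq_of_not_pos (h : Γ.SolvesEigenproblem μ f)
    (hμ : ∀ r : ℝ, 0 < r → μ ≠ r) {e : E} {x : ℝ} (hx : x ∈ Γ.interval e) :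
    onEdge f e x = onEdge f e 0 :=
  constant_of_derivWithin_zero (fun _ hy => (h.hasDeriv e hy).1)
    (fun _ hy => h.derivWithin_eq_zero hμ (Ico_subset_Icc_self hy)) x hx

end

/-- The function with component `α e * cos (k x) + β e * sin (k x)` on the edge `e`. -/
noncomputable def trigFun (k : ℝ) (α β : E → ℂ) : Γ.EdgeFun :=
  fun e x => α e * Real.cos (k * x) + β e * Real.sin (k * x)

theorem hasDerivAt_trig (k : ℝ) (A B : ℂ) (x : ℝ) :
    HasDerivAt (fun x : ℝ => A * Real.cos (k * x) + B * Real.sin (k * x))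
      (k * (-A * Real.sin (k * x) + B * Real.cos (k * x))) x := by
  have h1 : HasDerivAt (fun x : ℝ => Real.cos (k * x)) (-Real.sin (k * x) * k) x := by
    simpa using ((hasDerivAt_id x).const_mul k).cos
  have h2 : HasDerivAt (fun x : ℝ => Real.sin (k * x)) (Real.cos (k * x) * k) x := by
    simpa using ((hasDerivAt_id x).const_mul k).sin
  refine ((h1.ofReal_comp.const_mul A).add (h2.ofReal_comp.const_mul B)).congr_deriv ?_
  push_cast
  ring

variable {k : ℝ} {α β : E → ℂ}

theorem eqOn_onEdge_trigFun (e : E) : EqOn (onEdge (trigFun k α β : Γ.EdgeFun) e)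
    (fun x => α e * Real.cos (k * x) + β e * Real.sin (k * x)) (Γ.interval e) :=
  fun _ hx => onEdge_of_mem _ e hx

theorem derivWithin_onEdge_trigFun {e : E} {x : ℝ} (hx : x ∈ Γ.interval e) :
    derivWithin (onEdge (trigFun k α β : Γ.EdgeFun) e) (Γ.interval e) x =
      k * (-α e * Real.sin (k * x) + β e * Real.cos (k * x)) :=
  derivWithin_onEdge_of_eqOn (eqOn_onEdge_trigFun e) hx (hasDerivAt_trig k _ _ x)

theorem endValue_trigFun (e : E) :
    endValue (trigFun k α β : Γ.EdgeFun) (e, false) = α e ∧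
    endValue (trigFun k α β : Γ.EdgeFun) (e, true) =
      α e * Real.cos (k * Γ.length e) + β e * Real.sin (k * Γ.length e) := by
  constructor
  · rw [endValue, eqOn_onEdge_trigFun e (zero_mem_interval e)]
    simp
  · rw [endValue, eqOn_onEdge_trigFun e (length_mem_interval e)]

theorem endDeriv_trigFun (e : E) :
    endDeriv (trigFun k α β : Γ.EdgeFun) (e, false) = k * β e ∧
    endDeriv (trigFun k α β : Γ.EdgeFun) (e, true) =
      k * (α e * Real.sin (k * Γ.length e) - β e * Real.cos (k * Γ.length e)) := by
  constructor
  · rw [endDeriv, derivWithin_onEdge_trigFun (zero_mem_interval e)]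
    simp
  · rw [endDeriv, derivWithin_onEdge_trigFun (length_mem_interval e)]
    ring

variable [Fintype E] [DecidableEq V]

theorem solvesEigenproblem_trigFun_iff :
    Γ.SolvesEigenproblem ((k : ℂ) ^ 2) (trigFun k α β) ↔
      (∀ p q, Γ.vert p = Γ.vert q →
        endValue (trigFun k α β : Γ.EdgeFun) p = endValue (trigFun k α β : Γ.EdgeFun) q) ∧
      (∀ p, Γ.vert p ∈ Γ.dirichlet → endValue (trigFun k α β : Γ.EdgeFun) p = 0) ∧
      ∀ v, v ∉ Γ.dirichlet → ∑ p ∈ Finset.univ.filter (fun p => Γ.vert p = v),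
        endDeriv (trigFun k α β : Γ.EdgeFun) p = 0 := by
  refine ⟨fun h => ⟨h.continuous, h.vanish, h.current⟩, fun h => ⟨fun e => ?_, fun e x hx => ?_,
    h.1, h.2.1, h.2.2⟩⟩
  · refine ContDiffOn.congr ?_ (eqOn_onEdge_trigFun e)
    have hc : ContDiff ℝ 2 fun x : ℝ => ((Real.cos (k * x) : ℝ) : ℂ) :=
      Complex.ofRealCLM.contDiff.comp (Real.contDiff_cos.comp (contDiff_const.mul contDiff_id))
    have hs : ContDiff ℝ 2 fun x : ℝ => ((Real.sin (k * x) : ℝ) : ℂ) :=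
      Complex.ofRealCLM.contDiff.comp (Real.contDiff_sin.comp (contDiff_const.mul contDiff_id))
    exact ((contDiff_const.mul hc).add (contDiff_const.mul hs)).contDiffOn
  · have h1 : EqOn (derivWithin (onEdge (trigFun k α β : Γ.EdgeFun) e) (Γ.interval e))
        (fun x => (k * β e) * Real.cos (k * x) + (k * -α e) * Real.sin (k * x))
        (Γ.interval e) := fun y hy => by
      rw [derivWithin_onEdge_trigFun hy]
      ring
    rw [derivWithin_congr h1 (h1 hx), (hasDerivAt_trig k _ _ x).hasDerivWithinAt.derivWithin
      (uniqueDiffWithinAt_interval hx), eqOn_onEdge_trigFun e hx]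
    ring

theorem SolvesEigenproblem.exists_eq_trigFun (hk : k ≠ 0) {f : Γ.EdgeFun}
    (h : Γ.SolvesEigenproblem ((k : ℂ) ^ 2) f) : ∃ α β, f = trigFun k α β := by
  have hkC : (k : ℂ) ≠ 0 := Complex.ofReal_ne_zero.2 hk
  refine ⟨fun e => onEdge f e 0, fun e => derivWithin (onEdge f e) (Γ.interval e) 0 / k, ?_⟩
  funext e ⟨x, hx⟩
  set F := onEdge f e
  set F' := derivWithin F (Γ.interval e)
  have hF : ∀ y ∈ Γ.interval e, HasDerivWithinAt F (F' y) (Γ.interval e) y := fun y hy =>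
    h.hasDerivWithinAt hy
  have hF' : ∀ y ∈ Γ.interval e, HasDerivWithinAt F' (-((k : ℂ) ^ 2 * F y)) (Γ.interval e) y :=
    fun y hy => h.hasDerivWithinAt_derivWithin hy
  have hc : ∀ y : ℝ, HasDerivAt (fun x : ℝ => ((Real.cos (k * x) : ℝ) : ℂ))
      (-k * Real.sin (k * y)) y := fun y => by
    simpa using hasDerivAt_trig k 1 0 y
  have hs : ∀ y : ℝ, HasDerivAt (fun x : ℝ => ((Real.sin (k * x) : ℝ) : ℂ))
      (k * Real.cos (k * y)) y := fun y => by
    simpa using hasDerivAt_trig k 0 1 y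
  have hI : ∀ G G' : ℝ → ℂ, (∀ y ∈ Γ.interval e, HasDerivWithinAt G (G' y) (Γ.interval e) y) →
      (∀ y ∈ Γ.interval e, G' y = 0) → G x = G 0 := fun G G' hG hG' =>
    constant_of_derivWithin_zero (fun y hy => (hG y hy).differentiableWithinAt)
      (fun y hy => by
        have hy' := Ico_subset_Icc_self hy
        rw [(hG y hy').derivWithin (uniqueDiffWithinAt_interval hy'), hG' y hy']) x hx
  have e1 := hI _ _ (fun y hy => ((hF y hy).mul (hc y).hasDerivWithinAt).sub
    (((hF' y hy).mul (hs y).hasDerivWithinAt).div_const k)) (fun y _ => by field_simp; ring)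
  have e2 := hI _ _ (fun y hy => ((hF y hy).mul (hs y).hasDerivWithinAt).add
    (((hF' y hy).mul (hc y).hasDerivWithinAt).div_const k)) (fun y _ => by field_simp; ring)
  simp only [Pi.mul_apply, Pi.sub_apply, Pi.add_apply, mul_zero, Real.cos_zero, Real.sin_zero,
    Complex.ofReal_one, Complex.ofReal_zero, mul_one, zero_div, sub_zero, zero_add] at e1 e2
  have e3 : ((Real.sin (k * x) : ℝ) : ℂ) ^ 2 + ((Real.cos (k * x) : ℝ) : ℂ) ^ 2 = 1 := by
    exact_mod_cast Real.sin_sq_add_cos_sq (k * x)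
  have e4 : F x = f e ⟨x, hx⟩ := onEdge_of_mem f e hx
  rw [← e4]
  simp only [trigFun]
  linear_combination (Real.cos (k * x) : ℂ) * e1 + (Real.sin (k * x) : ℂ) * e2 - F x * e3

end QuantumGraph

section

open Matrix

theorem finrank_ker_mulVecLin_fin_two {K : Type*} [Field K] (M : Matrix (Fin 2) (Fin 2) K) :
    (M.det ≠ 0 → Module.finrank K (LinearMap.ker M.mulVecLin) = 0) ∧
    (M = 0 → Module.finrank K (LinearMap.ker M.mulVecLin) = 2) ∧
    (M.det = 0 → M ≠ 0 → Module.finrank K (LinearMap.ker M.mulVecLin) = 1) := by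
  have hbot : LinearMap.ker M.mulVecLin = ⊥ ↔ M.det ≠ 0 := by
    rw [Ne, ← Matrix.exists_mulVec_eq_zero_iff, LinearMap.ker_eq_bot']
    push Not
    simp only [Matrix.mulVecLin_apply]
    exact ⟨fun h v hv hv' => hv (h v hv'), fun h v hv => by_contra fun hv' => h v hv' hv⟩
  have htop : LinearMap.ker M.mulVecLin = ⊤ ↔ M = 0 := by
    rw [LinearMap.ker_eq_top, ← Matrix.toLin'_apply', map_eq_zero_iff _ Matrix.toLin'.injective]
  have hle := Submodule.finrank_le (LinearMap.ker M.mulVecLin)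
  rw [Module.finrank_fin_fun] at hle
  refine ⟨fun h => ?_, fun h => ?_, fun h h' => ?_⟩
  · rw [hbot.2 h, finrank_bot]
  · rw [htop.2 h, finrank_top, Module.finrank_fin_fun]
  · have h0 : Module.finrank K (LinearMap.ker M.mulVecLin) ≠ 0 := fun h0 =>
      hbot.1 (Submodule.finrank_eq_zero.1 h0) h
    have h2 : Module.finrank K (LinearMap.ker M.mulVecLin) ≠ 2 := fun h2 =>
      h' (htop.1 (Submodule.eq_top_of_finrank_eq (by rw [h2, Module.finrank_fin_fun])))
    omega

end

section dihedral

open QuantumGraph Matrix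

variable {a b c : ℝ} {ha : 0 < a} {hb : 0 < b} {hc : 0 < c}

theorem dihedralGraph_eq_zero_of_not_pos {μ : ℂ} (hμ : ∀ r : ℝ, 0 < r → μ ≠ r)
    {f : (dihedralGraph a b c ha hb hc).EdgeFun}
    (h : (dihedralGraph a b c ha hb hc).SolvesEigenproblem μ f) : f = 0 := by
  have hend : ∀ e, endValue f (e, true) = endValue f (e, false) := fun e =>
    h.onEdge_eq_of_not_pos hμ (length_mem_interval e)
  have h0 : endValue f (0, false) = 0 := h.vanish _ (by simp [dihedralGraph])
  have h1 : endValue f (1, false) = endValue f (0, true) :=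
    h.continuous _ _ (by simp [dihedralGraph])
  have h2 : endValue f (2, false) = endValue f (1, false) :=
    h.continuous _ _ (by simp [dihedralGraph])
  have h3 : endValue f (3, false) = endValue f (2, true) :=
    h.continuous _ _ (by simp [dihedralGraph])
  rw [hend, h0] at h1
  rw [h1] at h2
  rw [hend, h2] at h3
  have hall : ∀ e, onEdge f e 0 = 0 := by
    intro e
    change endValue f (e, false) = 0
    fin_cases e
    exacts [h0, h1, h2, h3]
  funext e x
  have := h.onEdge_eq_of_not_pos hμ x.2
  rw [onEdge_of_mem f e x.2, hall] at this
  exact this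

/-- The vertex conditions of the dihedral graph for a combination of cosines and sines. -/
theorem dihedralGraph_solvesEigenproblem_trigFun_iff {k : ℝ} (hk : k ≠ 0) {α β : Fin 4 → ℂ} :
    (dihedralGraph a b c ha hb hc).SolvesEigenproblem ((k : ℂ) ^ 2) (trigFun k α β) ↔
      α 0 = 0 ∧ α 1 = β 0 * Real.sin (k * a) ∧ α 2 = α 1 ∧
      α 1 * Real.cos (k * (2 * b)) + β 1 * Real.sin (k * (2 * b)) = α 3 ∧
      α 2 * Real.cos (k * (2 * c)) + β 2 * Real.sin (k * (2 * c)) = α 3 ∧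
      β 1 + β 2 = β 0 * Real.cos (k * a) ∧
      (α 1 * Real.sin (k * (2 * b)) - β 1 * Real.cos (k * (2 * b))) +
        (α 2 * Real.sin (k * (2 * c)) - β 2 * Real.cos (k * (2 * c))) + β 3 = 0 ∧
      α 3 * Real.sin (k * a) - β 3 * Real.cos (k * a) = 0 := by
  have hkC : (k : ℂ) ≠ 0 := Complex.ofReal_ne_zero.2 hk
  rw [solvesEigenproblem_trigFun_iff]
  generalize hval : endValue (trigFun k α β : (dihedralGraph a b c ha hb hc).EdgeFun) = val
  generalize hder : endDeriv (trigFun k α β : (dihedralGraph a b c ha hb hc).EdgeFun) = der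
  have v1 : ∀ e, val (e, false) = α e := fun e => hval ▸ (endValue_trigFun e).1
  have v2 : ∀ e, val (e, true) = α e * Real.cos (k * ![a, 2 * b, 2 * c, a] e) +
      β e * Real.sin (k * ![a, 2 * b, 2 * c, a] e) := fun e => hval ▸ (endValue_trigFun e).2
  have d1 : ∀ e, der (e, false) = k * β e := fun e => hder ▸ (endDeriv_trigFun e).1
  have d2 : ∀ e, der (e, true) = k * (α e * Real.sin (k * ![a, 2 * b, 2 * c, a] e) -
      β e * Real.cos (k * ![a, 2 * b, 2 * c, a] e)) := fun e => hder ▸ (endDeriv_trigFun e).2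
  have hcont : (∀ p q, (dihedralGraph a b c ha hb hc).vert p =
      (dihedralGraph a b c ha hb hc).vert q → val p = val q) ↔
      val (0, true) = val (1, false) ∧ val (2, false) = val (1, false) ∧
      val (1, true) = val (3, false) ∧ val (2, true) = val (3, false) := by
    refine ⟨fun h => ⟨h _ _ ?_, h _ _ ?_, h _ _ ?_, h _ _ ?_⟩, fun h => ?_⟩
    · simp [dihedralGraph]
    · simp [dihedralGraph]
    · simp [dihedralGraph]
    · simp [dihedralGraph]
    · obtain ⟨h1, h2, h3, h4⟩ := h
      rintro ⟨e, _ | _⟩ ⟨e', _ | _⟩ <;> fin_cases e <;> fin_cases e' <;>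
        simp [dihedralGraph, h1, h2, h3, h4]
  have hvan : (∀ p, (dihedralGraph a b c ha hb hc).vert p ∈
      (dihedralGraph a b c ha hb hc).dirichlet → val p = 0) ↔ val (0, false) = 0 := by
    refine ⟨fun h => h _ (by simp [dihedralGraph]), fun h => ?_⟩
    rintro ⟨e, _ | _⟩ <;> fin_cases e <;> simp [dihedralGraph, h]
  have hcur : (∀ v, v ∉ (dihedralGraph a b c ha hb hc).dirichlet →
      ∑ p ∈ Finset.univ.filter (fun p => (dihedralGraph a b c ha hb hc).vert p = v), der p = 0) ↔
      (der (0, true) + der (1, false) + der (2, false) = 0 ∧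
      der (1, true) + der (2, true) + der (3, false) = 0 ∧ der (3, true) = 0) := by
    have hsum : ∀ v, (∑ p ∈ Finset.univ.filter
        (fun p => (dihedralGraph a b c ha hb hc).vert p = v), der p) = ∑ e,
        ((if (dihedralGraph a b c ha hb hc).vert (e, true) = v then der (e, true) else 0) +
        if (dihedralGraph a b c ha hb hc).vert (e, false) = v then der (e, false) else 0) :=
      fun v => by
        rw [Finset.sum_filter, Fintype.sum_prod_type]
        simp only [Fintype.sum_bool]
    simp only [hsum]
    simp only [Fin.sum_univ_four, Fin.forall_fin_succ, dihedralGraph]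
    simp [add_assoc]
  rw [hcont, hvan, hcur]
  simp only [v1, v2, d1, d2, ← mul_add, mul_eq_zero, hkC, false_or]
  simp only [Matrix.cons_val]
  constructor
  · rintro ⟨⟨h1, h2, h3, h4⟩, h5, h6, h7, h8⟩
    rw [h5] at h1 h6
    refine ⟨h5, ?_, h2, h3, h4, ?_, h7, h8⟩
    · rw [← h1]; ring
    · linear_combination h6
  · rintro ⟨h1, h2, h3, h4, h5, h6, h7, h8⟩
    rw [h1]
    refine ⟨⟨?_, h3, h4, h5⟩, rfl, ?_, h7, h8⟩
    · rw [h2]; ring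
    · linear_combination h6

/-- The value at the Neumann leaf of the candidate eigenfunction with parameters `v`. -/
noncomputable def dihedralAmplitude (a b c k : ℝ) (v : Fin 2 → ℂ) : ℂ :=
  Real.cos (k * a) * (v 0 * Real.sin (k * a) * Real.cos (k * (2 * b)) +
    v 1 * Real.sin (k * (2 * b))) -
  Real.sin (k * a) * (v 0 * (Real.sin (k * a) * Real.sin (k * (2 * b)) +
    Real.sin (k * a) * Real.sin (k * (2 * c)) - Real.cos (k * a) * Real.cos (k * (2 * c))) +
    v 1 * (Real.cos (k * (2 * c)) - Real.cos (k * (2 * b))))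

/-- The amplitudes of the cosines on the edges; `dihedralSin` gives those of the sines. -/
noncomputable def dihedralCos (a b c k : ℝ) (v : Fin 2 → ℂ) : Fin 4 → ℂ :=
  ![0, v 0 * Real.sin (k * a), v 0 * Real.sin (k * a),
    dihedralAmplitude a b c k v * Real.cos (k * a)]

noncomputable def dihedralSin (a b c k : ℝ) (v : Fin 2 → ℂ) : Fin 4 → ℂ :=
  ![v 0, v 1, v 0 * Real.cos (k * a) - v 1, dihedralAmplitude a b c k v * Real.sin (k * a)]

noncomputable def dihedralTrial (a b c : ℝ) (ha : 0 < a) (hb : 0 < b) (hc : 0 < c) (k : ℝ) :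
    (Fin 2 → ℂ) →ₗ[ℂ] (dihedralGraph a b c ha hb hc).EdgeFun where
  toFun v := trigFun k (dihedralCos a b c k v) (dihedralSin a b c k v)
  map_add' v w := by
    funext e x
    fin_cases e <;> simp [trigFun, dihedralCos, dihedralSin, dihedralAmplitude] <;> ring
  map_smul' z v := by
    funext e x
    fin_cases e <;> simp [trigFun, dihedralCos, dihedralSin, dihedralAmplitude] <;> ring

/-- The secular matrix of the dihedral graph. -/
noncomputable def secularMatrix (a b c k : ℝ) : Matrix (Fin 2) (Fin 2) ℝ :=
  !![Real.sin (k * a) * (Real.cos (k * (2 * c)) - Real.cos (k * (2 * b))) +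
      Real.cos (k * a) * Real.sin (k * (2 * c)),
    -(Real.sin (k * (2 * b)) + Real.sin (k * (2 * c)));
    Real.sin (k * a) ^ 2 * Real.cos (k * (2 * b)) + Real.cos (k * a) * Real.sin (k * a) *
      (Real.sin (k * (2 * b)) + Real.sin (k * (2 * c))) -
      Real.cos (k * a) ^ 2 * Real.cos (k * (2 * c)),
    Real.sin (k * a) * Real.sin (k * (2 * b)) +
      Real.cos (k * a) * (Real.cos (k * (2 * c)) - Real.cos (k * (2 * b)))]

theorem dihedralTrial_injective {k : ℝ} (hk : k ≠ 0) :
    Function.Injective (dihedralTrial a b c ha hb hc k) := by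
  have hkC : (k : ℂ) ≠ 0 := Complex.ofReal_ne_zero.2 hk
  intro v w hvw
  have h : ∀ e, dihedralSin a b c k v e = dihedralSin a b c k w e := fun e => by
    have h1 := congrArg (fun f => endDeriv f (e, false)) hvw
    have h2 : ∀ u, endDeriv (dihedralTrial a b c ha hb hc k u) (e, false) =
        k * dihedralSin a b c k u e := fun u => (endDeriv_trigFun e).1
    simp only [h2] at h1
    exact mul_left_cancel₀ hkC h1
  funext i
  fin_cases i
  · exact h 0
  · exact h 1

theorem mulVecLin_secularMatrix_eq_zero_iff {k : ℝ} {v : Fin 2 → ℂ} :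
    ((secularMatrix a b c k).map Complex.ofReal).mulVecLin v = 0 ↔
    (v 0 * (Real.sin (k * a) * (Real.cos (k * (2 * c)) - Real.cos (k * (2 * b))) +
      Real.cos (k * a) * Real.sin (k * (2 * c))) -
      v 1 * (Real.sin (k * (2 * b)) + Real.sin (k * (2 * c))) = 0) ∧
    v 0 * (Real.sin (k * a) ^ 2 * Real.cos (k * (2 * b)) + Real.cos (k * a) * Real.sin (k * a) *
      (Real.sin (k * (2 * b)) + Real.sin (k * (2 * c))) -
      Real.cos (k * a) ^ 2 * Real.cos (k * (2 * c))) +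
    v 1 * (Real.sin (k * a) * Real.sin (k * (2 * b)) +
      Real.cos (k * a) * (Real.cos (k * (2 * c)) - Real.cos (k * (2 * b)))) = 0 := by
  rw [Matrix.mulVecLin_apply, funext_iff, Fin.forall_fin_two]
  simp only [Matrix.mulVec, dotProduct, Fin.sum_univ_two, Matrix.map_apply, secularMatrix,
    Matrix.of_apply, Matrix.cons_val, Pi.zero_apply]
  push_cast
  refine and_congr (Eq.congr_left ?_) (Eq.congr_left ?_) <;> ring

theorem eigenspace_dihedralGraph {k : ℝ} (hk : k ≠ 0) :
    (dihedralGraph a b c ha hb hc).eigenspace ((k : ℂ) ^ 2) =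
      (LinearMap.ker ((secularMatrix a b c k).map Complex.ofReal).mulVecLin).map
        (dihedralTrial a b c ha hb hc k) := by
  have e3 : ((Real.sin (k * a) : ℝ) : ℂ) ^ 2 + ((Real.cos (k * a) : ℝ) : ℂ) ^ 2 = 1 := by
    exact_mod_cast Real.sin_sq_add_cos_sq (k * a)
  ext f
  rw [Submodule.mem_map]
  constructor
  · intro h
    replace h : (dihedralGraph a b c ha hb hc).SolvesEigenproblem ((k : ℂ) ^ 2) f := h
    obtain ⟨α, β, rfl⟩ := h.exists_eq_trigFun hk
    rw [dihedralGraph_solvesEigenproblem_trigFun_iff hk] at h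
    obtain ⟨h1, h2, h3, h4, h5, h6, h7, h8⟩ := h
    have hβ2 : β 2 = β 0 * Real.cos (k * a) - β 1 := by rw [← h6]; ring
    rw [h2] at h3 h4 h7
    rw [h3, hβ2] at h5 h7
    rw [← h4] at h5 h8
    rw [eq_neg_of_add_eq_zero_right h7] at h8
    refine ⟨![β 0, β 1], ?_, ?_⟩
    · rw [LinearMap.mem_ker, mulVecLin_secularMatrix_eq_zero_iff]
      simp only [Matrix.cons_val_zero, Matrix.cons_val_one]
      constructor
      · linear_combination h5
      · linear_combination h8
    · change trigFun k _ _ = trigFun k α β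
      congr 1
      · funext e
        fin_cases e
        · exact h1.symm
        · exact h2.symm
        · exact h3.symm
        · change dihedralAmplitude a b c k ![β 0, β 1] * Real.cos (k * a) = α 3
          rw [← h4]
          simp only [dihedralAmplitude, Matrix.cons_val_zero, Matrix.cons_val_one]
          linear_combination (-(Real.sin (k * a) : ℂ)) * h8 +
            (β 0 * Real.sin (k * a) * Real.cos (k * (2 * b)) + β 1 * Real.sin (k * (2 * b))) * e3
      · funext e
        fin_cases e
        · rfl
        · rfl
        · exact hβ2.symm
        · change dihedralAmplitude a b c k ![β 0, β 1] * Real.sin (k * a) = β 3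
          rw [eq_neg_of_add_eq_zero_right h7]
          simp only [dihedralAmplitude, Matrix.cons_val_zero, Matrix.cons_val_one]
          linear_combination (Real.cos (k * a) : ℂ) * h8 -
            (β 0 * (Real.sin (k * a) * Real.sin (k * (2 * b)) +
              Real.sin (k * a) * Real.sin (k * (2 * c)) - Real.cos (k * a) * Real.cos (k * (2 * c)))
              + β 1 * (Real.cos (k * (2 * c)) - Real.cos (k * (2 * b)))) * e3
  · rintro ⟨v, hv, rfl⟩
    rw [LinearMap.mem_ker, mulVecLin_secularMatrix_eq_zero_iff] at hv
    obtain ⟨h1, h2⟩ := hv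
    change (dihedralGraph a b c ha hb hc).SolvesEigenproblem ((k : ℂ) ^ 2) (trigFun k _ _)
    rw [dihedralGraph_solvesEigenproblem_trigFun_iff hk]
    have hX : dihedralAmplitude a b c k v * Real.cos (k * a) =
        v 0 * Real.sin (k * a) * Real.cos (k * (2 * b)) + v 1 * Real.sin (k * (2 * b)) := by
      simp only [dihedralAmplitude]
      linear_combination (-(Real.sin (k * a) : ℂ)) * h2 +
        (v 0 * Real.sin (k * a) * Real.cos (k * (2 * b)) + v 1 * Real.sin (k * (2 * b))) * e3
    have hY : dihedralAmplitude a b c k v * Real.sin (k * a) =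
        -(v 0 * (Real.sin (k * a) * Real.sin (k * (2 * b)) +
          Real.sin (k * a) * Real.sin (k * (2 * c)) - Real.cos (k * a) * Real.cos (k * (2 * c)))
          + v 1 * (Real.cos (k * (2 * c)) - Real.cos (k * (2 * b)))) := by
      simp only [dihedralAmplitude]
      linear_combination (Real.cos (k * a) : ℂ) * h2 -
        (v 0 * (Real.sin (k * a) * Real.sin (k * (2 * b)) +
          Real.sin (k * a) * Real.sin (k * (2 * c)) - Real.cos (k * a) * Real.cos (k * (2 * c)))
          + v 1 * (Real.cos (k * (2 * c)) - Real.cos (k * (2 * b)))) * e3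
    simp only [dihedralCos, dihedralSin, Matrix.cons_val]
    refine ⟨trivial, trivial, trivial, hX.symm, ?_, by ring, ?_, by ring⟩
    · rw [hX]
      linear_combination h1
    · rw [hY]
      ring

theorem multiplicity_dihedralGraph {k : ℝ} (hk : k ≠ 0) :
    (dihedralGraph a b c ha hb hc).multiplicity ((k : ℂ) ^ 2) =
      Module.finrank ℂ (LinearMap.ker ((secularMatrix a b c k).map Complex.ofReal).mulVecLin) := by
  rw [QuantumGraph.multiplicity, eigenspace_dihedralGraph hk, ← (Submodule.equivMapOfInjective _
    (dihedralTrial_injective hk) _).rank_eq, ← Module.finrank_eq_rank]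
  simp

theorem multiplicity_dihedralGraph_of_not_pos {μ : ℂ} (hμ : ∀ r : ℝ, 0 < r → μ ≠ r) :
    (dihedralGraph a b c ha hb hc).multiplicity μ = 0 := by
  have : (dihedralGraph a b c ha hb hc).eigenspace μ = ⊥ :=
    (Submodule.eq_bot_iff _).2 fun f hf => dihedralGraph_eq_zero_of_not_pos hμ hf
  rw [QuantumGraph.multiplicity, this]
  simp

theorem det_secularMatrix (a b c k : ℝ) : 2 * (secularMatrix a b c k).det =
    -((Real.sin ((b - c) * k) ^ 2 - 5 * Real.sin ((b + c) * k) ^ 2) * Real.sin (2 * a * k) +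
      2 * Real.sin (2 * ((b + c) * k)) * Real.cos (2 * a * k)) := by
  have e2 := Real.sin_sq_add_cos_sq ((b + c) * k)
  have e3 := Real.sin_sq_add_cos_sq ((b - c) * k)
  have hb' : k * (2 * b) = (b + c) * k + (b - c) * k := by ring
  have hc' : k * (2 * c) = (b + c) * k - (b - c) * k := by ring
  have ha' : 2 * a * k = 2 * (k * a) := by ring
  rw [Matrix.det_fin_two, ha', Real.sin_two_mul, Real.sin_two_mul, Real.cos_two_mul']
  simp only [secularMatrix, Matrix.of_apply, Matrix.cons_val, hb', hc', Real.sin_add, Real.cos_add,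
    Real.sin_sub, Real.cos_sub]
  generalize Real.sin (k * a) = s
  generalize Real.cos (k * a) = t
  generalize Real.sin ((b + c) * k) = S at *
  generalize Real.cos ((b + c) * k) = C at *
  generalize Real.sin ((b - c) * k) = σ at *
  generalize Real.cos ((b - c) * k) = γ at *
  linear_combination (4 * S * C * (s ^ 2 - t ^ 2) + 10 * s * t * S ^ 2) * e3 -
    2 * s * t * σ ^ 2 * e2

theorem secularMatrix_eq_zero_iff (a b c k : ℝ) : secularMatrix a b c k = 0 ↔
    Real.sin ((b + c) * k) = 0 ∧ Real.sin ((b - c) * k) = 0 ∧ Real.cos (2 * a * k) = 0 := by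
  have e1 := Real.sin_sq_add_cos_sq (k * a)
  have e2 := Real.sin_sq_add_cos_sq ((b + c) * k)
  have e3 := Real.sin_sq_add_cos_sq ((b - c) * k)
  have hb' : k * (2 * b) = (b + c) * k + (b - c) * k := by ring
  have hc' : k * (2 * c) = (b + c) * k - (b - c) * k := by ring
  have ha' : 2 * a * k = 2 * (k * a) := by ring
  rw [ha', Real.cos_two_mul', ← Matrix.ext_iff]
  simp only [Fin.forall_fin_two, secularMatrix, Matrix.of_apply, Matrix.cons_val, hb', hc',
    Real.sin_add, Real.cos_add, Real.sin_sub, Real.cos_sub, Matrix.zero_apply]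
  generalize Real.sin (k * a) = s at *
  generalize Real.cos (k * a) = t at *
  generalize Real.sin ((b + c) * k) = S at *
  generalize Real.cos ((b + c) * k) = C at *
  generalize Real.sin ((b - c) * k) = σ at *
  generalize Real.cos ((b - c) * k) = γ at *
  constructor
  · rintro ⟨⟨h1, h2⟩, h3, h4⟩
    have h5 : S * γ = 0 := by linarith
    have h6 : σ * (2 * s * S - t * C) = 0 := by linear_combination h1 - t * h5
    have h7 : σ * (s * C + 2 * t * S) = 0 := by linear_combination h4 - s * h5
    have h8 : σ ^ 2 * (4 * S ^ 2 + C ^ 2) = 0 := by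
      linear_combination (σ * (2 * s * S - t * C)) * h6 + (σ * (s * C + 2 * t * S)) * h7 -
        σ ^ 2 * (4 * S ^ 2 + C ^ 2) * e1
    have hσ : σ = 0 := by
      have : 0 < 4 * S ^ 2 + C ^ 2 := by nlinarith [sq_nonneg S]
      simpa [this.ne'] using h8
    subst hσ
    have hγ : γ ≠ 0 := by rintro rfl; norm_num at e3
    have hS : S = 0 := by simpa [hγ] using h5
    subst hS
    have hC : C ≠ 0 := by rintro rfl; norm_num at e2
    refine ⟨rfl, rfl, ?_⟩
    have : (C * γ) * (t ^ 2 - s ^ 2) = 0 := by linear_combination -h3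
    simpa [hC, hγ] using this
  · rintro ⟨rfl, rfl, h⟩
    refine ⟨⟨by ring, by ring⟩, ?_, by ring⟩
    linear_combination (-(C * γ)) * h

end dihedral

section

open Real

theorem finite_sin_mul_eq_zero {ω : ℝ} (hω : 0 < ω) (K : ℝ) :
    ({k | sin (ω * k) = 0} ∩ Icc 0 K).Finite := by
  refine ((Set.finite_Icc (0 : ℤ) ⌈ω * K / π⌉).image fun n : ℤ => n * π / ω).subset ?_
  rintro k ⟨hk, hk0, hkK⟩
  obtain ⟨n, hn⟩ := sin_eq_zero_iff.1 hk
  refine ⟨n, ⟨?_, ?_⟩, ?_⟩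
  · have h1 : (0 : ℝ) ≤ n * π := by rw [hn]; positivity
    exact_mod_cast nonneg_of_mul_nonneg_left h1 pi_pos
  · have h1 : (n : ℝ) ≤ ω * K / π := by
      rw [le_div_iff₀ pi_pos, hn]
      gcongr
    exact_mod_cast h1.trans (Int.le_ceil _)
  · simp only [hn]
    field_simp

theorem infinite_sin_mul_eq_zero {ω : ℝ} (hω : 0 < ω) :
    {k | 0 < k ∧ sin (ω * k) = 0}.Infinite := by
  refine infinite_of_injective_forall_mem (f := fun n : ℕ => (n + 1 : ℕ) * π / ω) ?_ fun n => ?_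
  · intro m n h
    have := pi_pos.ne'
    field_simp at h
    exact Nat.succ_injective (by exact_mod_cast h)
  · refine ⟨by positivity, ?_⟩
    rw [mul_div_cancel₀ _ hω.ne']
    exact sin_nat_mul_pi _

theorem encard_pi_div_mul_eq {ω : ℝ} (hω : 0 < ω) (x : ℝ) :
    {n : ℕ | 1 ≤ n ∧ π / ω * n = x}.encard = {k | 0 < k ∧ sin (ω * k) = 0}.indicator 1 x := by
  by_cases hx : 0 < x ∧ sin (ω * x) = 0
  · obtain ⟨m, hm⟩ := sin_eq_zero_iff.1 hx.2
    have hm0 : (0 : ℝ) < m * π := by rw [hm]; exact mul_pos hω hx.1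
    have hm1 : 0 < m := by exact_mod_cast pos_of_mul_pos_left hm0 pi_pos.le
    lift m to ℕ using hm1.le
    have hset : {n : ℕ | 1 ≤ n ∧ π / ω * n = x} = {m} := by
      ext n
      simp only [mem_ofPred_eq, mem_singleton_iff]
      have hxm : x = π / ω * m := by
        field_simp
        rw [mul_comm x, ← hm]
        push_cast
        ring
      have hne : π / ω ≠ 0 := by positivity
      constructor
      · rintro ⟨-, h⟩
        rw [hxm] at h
        exact_mod_cast mul_left_cancel₀ hne h
      · rintro rfl
        exact ⟨by exact_mod_cast hm1, hxm.symm⟩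
    rw [hset, encard_singleton, indicator_of_mem (by exact hx)]
    rfl
  · rw [indicator_of_notMem (by exact hx), encard_eq_zero, eq_empty_iff_forall_notMem]
    rintro n ⟨hn, rfl⟩
    refine hx ⟨?_, ?_⟩
    · have : (0 : ℝ) < n := by exact_mod_cast hn
      positivity
    · rw [← mul_assoc, mul_div_cancel₀ _ hω.ne', mul_comm]
      exact sin_nat_mul_pi n

end

section

open Real QuantumGraph

/-- The poles of the secular function of the dihedral graph. -/
def secularPoles (a b c : ℝ) : Set ℝ :=
  {k | sin (2 * a * k) = 0} ∪ cyclePoles (b + c) (b - c)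

noncomputable def secularFun (a b c k : ℝ) : ℝ :=
  2 * cos (2 * a * k) / sin (2 * a * k) + cycleSecular (b + c) (b - c) k

def secularZeros (a b c : ℝ) : Set ℝ :=
  {k | 0 < k ∧ k ∉ secularPoles a b c ∧ secularFun a b c k = 0}

/-- The points at which the multiplicities in both spectra are one higher than what the zeros and
the poles of the secular function account for. -/
def commonPoints (a b c : ℝ) : Set ℝ :=
  {k | 0 < k ∧ sin (2 * ((b + c) * k)) = 0 ∧
    (sin (2 * a * k) = 0 ∨ (sin ((b + c) * k) = 0 ∧ sin ((b - c) * k) = 0))}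

theorem cos_ne_zero_of_sin_eq_zero {x : ℝ} (h : sin x = 0) : cos x ≠ 0 := fun hc => by
  have := sin_sq_add_cos_sq x
  rw [h, hc] at this
  norm_num at this

variable {a b c : ℝ}

theorem pairMultiplicity_secularPoles_commonPoints (x : ℝ) :
    {k | 0 < k ∧ sin (2 * a * k) = 0}.indicator (1 : ℝ → ℕ∞) x +
      {k | 0 < k ∧ sin (2 * (b + c) * k) = 0}.indicator 1 x =
    pairMultiplicity (secularPoles a b c ∩ Ioi 0) (commonPoints a b c) x := by
  classical
  have h2 : sin (2 * (b + c) * x) = 0 ↔ sin ((b + c) * x) = 0 ∨ cos ((b + c) * x) = 0 := by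
    rw [mul_assoc, sin_two_mul]; simp
  have h3 : sin (2 * ((b + c) * x)) = 0 ↔ sin ((b + c) * x) = 0 ∨ cos ((b + c) * x) = 0 := by
    rw [sin_two_mul]; simp
  have h4 := @cos_ne_zero_of_sin_eq_zero ((b + c) * x)
  simp only [pairMultiplicity, indicator_apply, secularPoles, cyclePoles, commonPoints,
    mem_inter_iff, mem_union, mem_Ioi, mem_ofPred_eq, h2, h3, Pi.one_apply]
  by_cases hx : 0 < x <;> by_cases hA : sin (2 * a * x) = 0 <;>
    by_cases hS : sin ((b + c) * x) = 0 <;> by_cases hC : cos ((b + c) * x) = 0 <;>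
    by_cases hs : sin ((b - c) * x) = 0 <;> simp [hx, hA, hS, hC, hs]
  all_goals exact (h4 hS hC).elim

theorem multiplicity_dihedralGraph_eq {ha : 0 < a} {hb : 0 < b} {hc : 0 < c} {k : ℝ} (hk : 0 < k) :
    (dihedralGraph a b c ha hb hc).multiplicity ((k : ℂ) ^ 2) =
      pairMultiplicity (secularZeros a b c) (commonPoints a b c) k := by
  classical
  rw [multiplicity_dihedralGraph hk.ne']
  obtain ⟨r0, r2, r1⟩ := finrank_ker_mulVecLin_fin_two ((secularMatrix a b c k).map Complex.ofReal)
  have hdet : ((secularMatrix a b c k).map Complex.ofReal).det = 0 ↔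
      (secularMatrix a b c k).det = 0 := by
    have := Complex.ofRealHom.map_det (secularMatrix a b c k)
    rw [RingHom.mapMatrix_apply] at this
    change _ = ((secularMatrix a b c k).map Complex.ofReal).det at this
    rw [← this]
    simp
  have hzero : (secularMatrix a b c k).map Complex.ofReal = 0 ↔
      Real.sin ((b + c) * k) = 0 ∧ Real.sin ((b - c) * k) = 0 ∧ Real.cos (2 * a * k) = 0 := by
    rw [← secularMatrix_eq_zero_iff, ← Matrix.ext_iff, ← Matrix.ext_iff]
    simp
  have hdet' : (secularMatrix a b c k).det = 0 ↔
      (sin ((b - c) * k) ^ 2 - 5 * sin ((b + c) * k) ^ 2) * sin (2 * a * k) +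
      2 * sin (2 * ((b + c) * k)) * cos (2 * a * k) = 0 := by
    have := det_secularMatrix a b c k
    constructor <;> intro h <;> linarith
  rw [Ne, hdet, hdet'] at r0
  rw [hdet, hdet', Ne, hzero] at r1
  rw [hzero] at r2
  have h3 : sin (2 * ((b + c) * k)) = 0 ↔ sin ((b + c) * k) = 0 ∨ cos ((b + c) * k) = 0 := by
    rw [sin_two_mul]; simp
  have hsq := sin_sq_add_cos_sq ((b + c) * k)
  have hcS := @cos_ne_zero_of_sin_eq_zero ((b + c) * k)
  have hcA := @cos_ne_zero_of_sin_eq_zero (2 * a * k)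
  simp only [pairMultiplicity, indicator_apply, secularZeros, secularFun, cycleSecular,
    secularPoles, cyclePoles, commonPoints, mem_union, mem_ofPred_eq, Pi.one_apply, hk, true_and]
  by_cases hA : sin (2 * a * k) = 0
  · by_cases hS2 : sin (2 * ((b + c) * k)) = 0
    · rw [r1 (by simp [hA, hS2]) fun h => hcA hA h.2.2]
      simp [hA, hS2]
    · rw [r0 (by simp [hA, hS2, hcA hA])]
      simp [hA, hS2]
  by_cases hC : cos ((b + c) * k) = 0
  · have hS : sin ((b + c) * k) ≠ 0 := fun h => hcS h hC
    have hne : sin ((b - c) * k) ^ 2 - 5 * sin ((b + c) * k) ^ 2 ≠ 0 := by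
      have := sin_sq_le_one ((b - c) * k)
      rw [hC] at hsq
      intro h
      linarith
    have hS2 := h3.2 (Or.inr hC)
    rw [r0 (by simp [hS2, hA, hne])]
    simp [hA, hC, hS]
  by_cases hS : sin ((b + c) * k) = 0
  · have hS2 := h3.2 (Or.inl hS)
    by_cases hs : sin ((b - c) * k) = 0
    · by_cases hcos : cos (2 * a * k) = 0
      · rw [r2 ⟨hS, hs, hcos⟩]
        simp [hA, hC, hS, hs, hcos, hS2]
        norm_num
      · rw [r1 (by simp [hS, hs, hS2]) fun h => hcos h.2.2]
        simp [hA, hC, hS, hs, hcos, hS2]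
    · rw [r0 (by simp [hS2, hA, hS, hs])]
      simp [hA, hC, hS, hs]
  have hS2 : sin (2 * ((b + c) * k)) ≠ 0 := fun h => (h3.1 h).elim hS hC
  have hG : 2 * cos (2 * a * k) / sin (2 * a * k) +
      (sin ((b - c) * k) ^ 2 - 5 * sin ((b + c) * k) ^ 2) / sin (2 * ((b + c) * k)) = 0 ↔
      (sin ((b - c) * k) ^ 2 - 5 * sin ((b + c) * k) ^ 2) * sin (2 * a * k) +
      2 * sin (2 * ((b + c) * k)) * cos (2 * a * k) = 0 := by
    rw [div_add_div _ _ hA hS2, div_eq_zero_iff, or_iff_left (mul_ne_zero hA hS2)]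
    constructor <;> intro h <;> linarith
  simp only [hG]
  by_cases hF : (sin ((b - c) * k) ^ 2 - 5 * sin ((b + c) * k) ^ 2) * sin (2 * a * k) +
      2 * sin (2 * ((b + c) * k)) * cos (2 * a * k) = 0
  · rw [r1 hF fun h => hS h.1]
    simp [hA, hC, hS, hS2, hF]
  · rw [r0 hF]
    simp [hF, hS2]

theorem finite_secularPoles (ha : 0 < a) (hb : 0 < b) (hc : 0 < c) (K : ℝ) :
    (secularPoles a b c ∩ Icc 0 K).Finite := by
  refine ((finite_sin_mul_eq_zero (mul_pos two_pos ha) K).union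
    (finite_sin_mul_eq_zero (mul_pos two_pos (add_pos hb hc)) K)).subset ?_
  rintro k ⟨h | h, hk⟩
  · exact Or.inl ⟨h, hk⟩
  · refine Or.inr ⟨?_, hk⟩
    rw [mem_ofPred_eq, mul_assoc, sin_two_mul]
    rcases h with h | h
    · rw [h, mul_zero]
    · rw [h.1, mul_zero, zero_mul]

theorem finite_commonPoints (hb : 0 < b) (hc : 0 < c) (K : ℝ) :
    (commonPoints a b c ∩ Iic K).Finite := by
  refine (finite_sin_mul_eq_zero (mul_pos two_pos (add_pos hb hc)) K).subset ?_
  rintro k ⟨hk, hkK⟩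
  refine ⟨?_, hk.1.le, hkK⟩
  rw [mem_ofPred_eq, mul_assoc]
  exact hk.2.1

theorem isCotangentLike_secularFun (ha : 0 < a) (hb : 0 < b) (hc : 0 < c) :
    IsCotangentLike (secularFun a b c) (secularPoles a b c) :=
  (isCotangentLike_cos_div_sin (mul_pos two_pos ha)).add
    (isCotangentLike_cycleSecular (abs_sub_lt_iff.2 ⟨by linarith, by linarith⟩))

theorem secularZeros_interlace (ha : 0 < a) (hb : 0 < b) (hc : 0 < c) (K : ℝ) :
    (secularZeros a b c ∩ Iic K).Finite ∧
    (secularPoles a b c ∩ Ioi 0 ∩ Iic K).ncard ≤ (secularZeros a b c ∩ Iic K).ncard ∧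
    (secularZeros a b c ∩ Iic K).ncard ≤ (secularPoles a b c ∩ Ioi 0 ∩ Iic K).ncard + 1 :=
  (isCotangentLike_secularFun ha hb hc).finite_and_ncard_le (Or.inl (by simp))
    (finite_secularPoles ha hb hc) K

theorem infinite_secularPoles (ha : 0 < a) : (secularPoles a b c ∩ Ioi 0).Infinite :=
  (infinite_sin_mul_eq_zero (mul_pos two_pos ha)).mono fun _ hk => ⟨Or.inl hk.2, hk.1⟩

theorem infinite_secularZeros (ha : 0 < a) (hb : 0 < b) (hc : 0 < c) :
    (secularZeros a b c).Infinite := by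
  intro hfin
  obtain ⟨t, htA, htn⟩ := (infinite_secularPoles (b := b) (c := c) ha).exists_subset_card_eq
    ((secularZeros a b c).ncard + 1)
  obtain ⟨K, hK⟩ := t.bddAbove
  have h1 : (t : Set ℝ).ncard ≤ (secularPoles a b c ∩ Ioi 0 ∩ Iic K).ncard :=
    ncard_le_ncard (fun x hx => ⟨htA hx, hK hx⟩) ((finite_secularPoles ha hb hc K).subset
      fun x hx => ⟨hx.1.1, (mem_Ioi.1 hx.1.2).le, hx.2⟩)
  rw [ncard_coe_finset, htn] at h1
  have h2 := (secularZeros_interlace ha hb hc K).2.1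
  have h3 : (secularZeros a b c ∩ Iic K).ncard ≤ (secularZeros a b c).ncard :=
    ncard_le_ncard inter_subset_left hfin
  omega

theorem isOrderedSigmaTilde_iff (ha : 0 < a) (hb : 0 < b) (hc : 0 < c) {s : ℕ → ℝ} :
    IsOrderedSigmaTilde a b c s ↔ IsEnumeration
      (pairMultiplicity (secularPoles a b c ∩ Ioi 0) (commonPoints a b c)) s := by
  simp only [IsOrderedSigmaTilde, IsEnumeration, encard_pi_div_mul_eq (mul_pos two_pos ha),
    encard_pi_div_mul_eq (mul_pos two_pos (add_pos hb hc)),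
    pairMultiplicity_secularPoles_commonPoints]

theorem pos_of_pairMultiplicity_ne_zero {k : ℝ}
    (h : pairMultiplicity (secularZeros a b c) (commonPoints a b c) k ≠ 0) : 0 < k := by
  by_contra hk
  refine h ?_
  rw [pairMultiplicity, indicator_of_notMem (fun h => hk h.1), indicator_of_notMem
    (fun h => hk h.1), add_zero]

theorem encard_fiber_ne_zero {α : Type*} (s : ℕ → α) (n : ℕ) : {m | s m = s n}.encard ≠ 0 := by
  rw [encard_ne_zero]
  exact ⟨n, rfl⟩

variable {ha : 0 < a} {hb : 0 < b} {hc : 0 < c}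

theorem isEnumeration_sqrt_of_isOrderedSpectrum {lam : ℕ → ℝ}
    (h : (dihedralGraph a b c ha hb hc).IsOrderedSpectrum lam) :
    IsEnumeration (pairMultiplicity (secularZeros a b c) (commonPoints a b c))
      fun n => √(lam n) := by
  have hpos : ∀ n, 0 < lam n := by
    intro n
    by_contra hn
    have h1 := h.2 (lam n)
    rw [multiplicity_dihedralGraph_of_not_pos] at h1
    · simp only [Complex.ofReal_inj] at h1
      exact encard_fiber_ne_zero lam n h1
    · intro r hr heq
      rw [Complex.ofReal_inj] at heq
      exact hn (heq ▸ hr)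
  refine ⟨fun m n hmn => sqrt_le_sqrt (h.1 hmn), fun k => ?_⟩
  by_cases hk : 0 < k
  · rw [← multiplicity_dihedralGraph_eq (ha := ha) (hb := hb) (hc := hc) hk, ← h.2]
    congr 1
    ext n
    rw [mem_ofPred_eq, mem_ofPred_eq, sqrt_eq_iff_eq_sq (hpos n).le hk.le]
    norm_cast
  · rw [not_not.1 (mt pos_of_pairMultiplicity_ne_zero hk), encard_eq_zero,
      eq_empty_iff_forall_notMem]
    rintro n rfl
    exact hk (sqrt_pos.2 (hpos n))

theorem isOrderedSpectrum_sq_of_isEnumeration {s : ℕ → ℝ}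
    (h : IsEnumeration (pairMultiplicity (secularZeros a b c) (commonPoints a b c)) s) :
    (dihedralGraph a b c ha hb hc).IsOrderedSpectrum fun n => s n ^ 2 := by
  have hpos : ∀ n, 0 < s n := fun n => pos_of_pairMultiplicity_ne_zero
    (h.2 (s n) ▸ encard_fiber_ne_zero s n)
  refine ⟨fun m n hmn => pow_le_pow_left₀ (hpos m).le (h.1 hmn) 2, fun μ => ?_⟩
  by_cases hμ : ∃ r : ℝ, 0 < r ∧ μ = r
  · obtain ⟨r, hr, rfl⟩ := hμ
    have hsq : (r : ℂ) = ((√r : ℝ) : ℂ) ^ 2 := by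
      rw [← Complex.ofReal_pow, sq_sqrt hr.le]
    rw [hsq, multiplicity_dihedralGraph_eq (sqrt_pos.2 hr), ← h.2, ← hsq]
    congr 1
    ext n
    rw [mem_ofPred_eq, mem_ofPred_eq, Complex.ofReal_inj, eq_comm, ← sqrt_eq_iff_eq_sq hr.le
      (hpos n).le, eq_comm]
  · rw [multiplicity_dihedralGraph_of_not_pos fun r hr heq => hμ ⟨r, hr, heq⟩, encard_eq_zero,
      eq_empty_iff_forall_notMem]
    rintro n rfl
    exact hμ ⟨_, pow_pos (hpos n) 2, rfl⟩

end

theorem mainTheorem2 (a b c : ℝ) (ha : 0 < a) (hb : 0 < b) (hc : 0 < c) :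
    (∃ lam : ℕ → ℝ, (dihedralGraph a b c ha hb hc).IsOrderedSpectrum lam) ∧
    (∃ lamT : ℕ → ℝ, IsOrderedSigmaTilde a b c lamT) ∧
    ∀ lam lamT : ℕ → ℝ,
      (dihedralGraph a b c ha hb hc).IsOrderedSpectrum lam →
      IsOrderedSigmaTilde a b c lamT →
      ∀ n : ℕ, √(lam n) ≤ lamT n ∧ lamT n ≤ √(lam (n + 1)) := by
  have hcount := secularZeros_interlace ha hb hc
  have hR := finite_commonPoints (a := a) hb hc
  have hQ : ∀ K, (secularPoles a b c ∩ Ioi 0 ∩ Iic K).Finite := fun K =>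
    (finite_secularPoles ha hb hc K).subset
      fun x hx => ⟨hx.1.1, (mem_Ioi.1 hx.1.2).le, hx.2⟩
  refine ⟨?_, ?_, fun lam lamT h hT => ?_⟩
  · obtain ⟨s, hs⟩ := exists_isEnumeration (fun K => (hcount K).1) hR
      (infinite_secularZeros ha hb hc)
    exact ⟨_, isOrderedSpectrum_sq_of_isEnumeration hs⟩
  · obtain ⟨s, hs⟩ := exists_isEnumeration hQ hR (infinite_secularPoles ha)
    exact ⟨s, (isOrderedSigmaTilde_iff ha hb hc).2 hs⟩
  · exact (isEnumeration_sqrt_of_isOrderedSpectrum h).interlace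
      ((isOrderedSigmaTilde_iff ha hb hc).1 hT) (fun K => (hcount K).1) hQ hR
      (fun K => (hcount K).2.1) fun K => (hcount K).2.2
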